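/- **Setting.** Let $K,N\ge 0$ be integers and let $f(\cdot\mid\theta)$, $\theta\in\{0,1\}^N$, be probability densities, with respect to a common $\sigma$-finite measure, of a random vector $X=(X^1,\dots,X^K)$ (the $K$ components take values in arbitrary measurable spaces and may be dependent). For $A\subseteq\{1,\dots,N\}$ let $\theta_A$ be the indicator vector of $A$. Let $X_1,X_2,\dots$ be the coordinates on the space of observation sequences, $\mathcal F_t=\sigma(X_1,\dots,X_t)$. Under $\mathsf P_\infty$ the $X_t$ are i.i.d. with density $f(\cdot\mid 0)$; under $\mathsf P_\nu^A$ ($\nu=0,1,2,\dots$) they are independent, with density $f(\cdot\mid 0)$ for $t\le\nu$ and $f(\cdot\mid\theta_A)$ for $t>\nu$. Let $\mathcal P$ be an arbitrary class of subsets of $\{1,\dots,N\}$, and let $p_A>0$ ($A\in\mathcal P$) be weights, not depending on $\gamma$, with $\sum_{A\in\mathcal P}p_A=1$. Assume that, for each $A\in\mathcal P$, the law $f(\cdot\mid\theta_A)$ is absolutely continuous with respect to $f(\cdot\mid 0)$, and put $$\ell_t^A=\log\frac{f(X_t\mid\theta_A)}{f(X_t\mid 0)}\in[-\infty,\infty),\qquad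 Z_t^A-Z_s^A=\sum_{r=s+1}^t\ell_r^A\quad(0\le s\le t),\qquad I_A=\mathsf E_0^A[\ell_1^A],$$ $$Y_t^A=\max_{0\le s\le t}(Z_t^A-Z_s^A),\qquad \tilde Y_t^A=\max_{0\le s<t}(Z_t^A-Z_s^A).$$ For $b\in\mathbb R$ consider the stopping rules (with $\inf\emptyset=\infty$) $$S_b=\inf\Big\{t\ge1:\max_{A\in\mathcal P}(Y_t^A+\log p_A)\ge b\Big\},\qquad \bar S_b=\inf\Big\{t\ge1:\max_{0\le s\le t}\sum_{A\in\mathcal P}p_A e^{Z_t^A-Z_s^A}\ge e^b\Big\},$$ $$\tilde S_b=\inf\Big\{t\ge1:\sum_{A\in\mathcal P}p_A e^{\tilde Y_t^A}\ge e^b\Big\}.$$ For $\gamma\ge1$ let $\mathcal C_\gamma$ be the class of $(\mathcal F_t)$-stopping times $T$ (with values in $\{0,1,2,\dots\}\cup\{\infty\}$) with $\mathsf E_\infty[T]\ge\gamma$, and let $$\mathcal J_A[T]=\sup_{\nu\ge0}\operatorname{ess\,sup}\mathsf E_\nu^A[(T-\nu)^+\mid\mathcal F_\nu]$$ be Lorden's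 worst-case delay. **Theorem.** (i) For every $\gamma\ge1$, with $b=\log\gamma$, we have $S_b,\bar S_b,\tilde S_b\in\mathcal C_\gamma$. (ii) Suppose that, for every $A\in\mathcal P$, the laws $f(\cdot\mid\theta_A)$ and $f(\cdot\mid 0)$ are different and $\ell_1^A$ is square-integrable under $\mathsf P_0^A$. Then each of the three rules, with $b=\log\gamma$, is second-order asymptotically optimal with respect to $\mathcal P$: if $T_\gamma$ denotes any one of $S_{\log\gamma},\bar S_{\log\gamma},\tilde S_{\log\gamma}$, then $T_\gamma\in\mathcal C_\gamma$ for every $\gamma\ge1$ and, for every $A\in\mathcal P$, as $\gamma\to\infty$, $\mathcal J_A[T_\gamma]$ is finite for all large $\gamma$ and $$\mathcal J_A[T_\gamma]-\inf_{T\in\mathcal C_\gamma}\mathcal J_A[T]=O(1).$$ Moreover, for every $A\in\mathcal P$, $$\mathcal J_A[T_\gamma]=\frac{\log\gamma}{I_A}+O(1)\qquad(\gamma\to\infty).$$ The $O(1)$ bounds may depend on $A$, on the weights and on the model, but not on $\gamma$. -/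

import Mathlib

open MeasureTheory Filter Asymptotics
open scoped ENNReal NNReal

/-- A `K`-sensor observation model whose one-step law depends on an `N`-dimensional parameter
`θ ∈ {0, 1}^N`: a family `f(· | θ)` of probability densities of the observation vector
`(X_t^1, …, X_t^K)` with respect to one common dominating σ-finite measure. Sensor `k` takes
values in the measurable space `E k`, and the sensors need not be independent. -/
structure SensorModel {K : ℕ} (E : Fin K → Type*) [∀ k, MeasurableSpace (E k)] (N : ℕ) where
  /-- the dominating measure -/
  base : Measure (∀ k, E k)
  sigmaFinite_base : SigmaFinite base
  /-- the densities `f(· | θ)` -/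
  density : (Fin N → Fin 2) → (∀ k, E k) → ℝ≥0
  measurable_density : ∀ θ, Measurable (density θ)
  lintegral_density : ∀ θ, ∫⁻ x, (density θ x : ℝ≥0∞) ∂base = 1

namespace SensorModel

noncomputable section

variable {K N : ℕ} {E : Fin K → Type*} [∀ k, MeasurableSpace (E k)]

/-- Observation sequences. The observation vector `X_t` at time `t = 1, 2, …` is the coordinate
`ω (t - 1)`, so that `X_{s+1}, …, X_t` are the coordinates `ω u` with `s ≤ u < t`. -/
abbrev Path {K : ℕ} (E : Fin K → Type*) : Type _ := ℕ → ∀ k, E k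

/-- `F_t = σ(X_1, …, X_t)`; in particular `F_0` is trivial. -/
def filtration (E : Fin K → Type*) [∀ k, MeasurableSpace (E k)] :
    Filtration ℕ (inferInstance : MeasurableSpace (Path E)) where
  seq t := ⨆ (u : ℕ) (_ : u < t), MeasurableSpace.comap (fun ω : Path E => ω u) inferInstance
  mono' := fun _ _ hst => iSup₂_le fun u hu =>
    le_iSup₂ (f := fun (u : ℕ) (_ : u < _) =>
      MeasurableSpace.comap (fun ω : Path E => ω u) inferInstance) u (lt_of_lt_of_le hu hst)
  le' := fun _ => iSup₂_le fun u _ => (measurable_pi_apply u).comap_le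

/-- The parameter vector with components `1` on `A` and `0` off `A`. -/
def param (A : Finset (Fin N)) : Fin N → Fin 2 := fun k => if k ∈ A then 1 else 0

variable (M : SensorModel E N)

/-- The law of one observation vector under the parameter `θ`. -/
def law (θ : Fin N → Fin 2) : Measure (∀ k, E k) :=
  M.base.withDensity fun x => (M.density θ x : ℝ≥0∞)

instance isProbabilityMeasure_law (θ : Fin N → Fin 2) : IsProbabilityMeasure (M.law θ) :=
  ⟨by rw [law, withDensity_apply _ MeasurableSet.univ, Measure.restrict_univ,
    M.lintegral_density θ]⟩

/-- `P_∞`: independent observations, all with parameter `0` (no change ever). -/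
def noChange : Measure (Path E) := Measure.infinitePi fun _ => M.law 0

/-- `P_ν^A`: independent observations, `X_t` having parameter `0` for `t ≤ ν`, and the parameter
that is `1` exactly on `A` for `t > ν`. -/
def change (A : Finset (Fin N)) (ν : ℕ) : Measure (Path E) :=
  Measure.infinitePi fun u => M.law (if u < ν then 0 else param A)

instance isProbabilityMeasure_noChange : IsProbabilityMeasure M.noChange := by
  unfold noChange; infer_instance

instance isProbabilityMeasure_change (A : Finset (Fin N)) (ν : ℕ) :
    IsProbabilityMeasure (M.change A ν) := by
  unfold change; infer_instance

/-- The one-observation log-likelihood ratio `x ↦ log (f(x | A) / f(x | 0))`, with value `-∞`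
where the numerator alone vanishes; `ℓ_t^A` is its value at `X_t`. -/
def logLR (A : Finset (Fin N)) (x : ∀ k, E k) : EReal :=
  ENNReal.log ((M.density (param A) x : ℝ≥0∞) / (M.density 0 x : ℝ≥0∞))

/-- `Z_t^A - Z_s^A = ∑_{s < r ≤ t} ℓ_r^A`, for `s ≤ t`. -/
def logLRIncr (A : Finset (Fin N)) (s t : ℕ) (ω : Path E) : EReal :=
  ∑ u ∈ Finset.Ico s t, M.logLR A (ω u)

/-- The nonnegative CUSUM statistic `Y_t^A = max_{0 ≤ s ≤ t} (Z_t^A - Z_s^A)`. -/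
def cusumY (A : Finset (Fin N)) (t : ℕ) (ω : Path E) : EReal :=
  ⨆ s ∈ Finset.range (t + 1), M.logLRIncr A s t ω

/-- The CUSUM statistic `Ỹ_t^A = max_{0 ≤ s < t} (Z_t^A - Z_s^A)`, for `t ≥ 1`. -/
def cusumYTilde (A : Finset (Fin N)) (t : ℕ) (ω : Path E) : EReal :=
  ⨆ s ∈ Finset.range t, M.logLRIncr A s t ω

/-- `I_A = E_0^A[ℓ_1^A]`. -/
def info (A : Finset (Fin N)) : ℝ := ∫ ω, (M.logLR A (ω 0)).toReal ∂(M.change A 0)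

/-- The weighted GLR-CUSUM
`S_b = inf {t ≥ 1 : max_{A ∈ P} (Y_t^A + log p_A) ≥ b}`. -/
def glrCusum (P : Finset (Finset (Fin N))) (p : Finset (Fin N) → ℝ) (b : ℝ) :
    Path E → WithTop ℕ :=
  hittingAfter (fun t ω => ⨆ A ∈ P, (M.cusumY A t ω + ((Real.log (p A) : ℝ) : EReal)))
    (Set.Ici (b : EReal)) 1

/-- The mixture CUSUM
`S̄_b = inf {t ≥ 1 : max_{0 ≤ s ≤ t} ∑_{A ∈ P} p_A exp(Z_t^A - Z_s^A) ≥ e^b}`. -/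
def mixCusumBar (P : Finset (Finset (Fin N))) (p : Finset (Fin N) → ℝ) (b : ℝ) :
    Path E → WithTop ℕ :=
  hittingAfter (fun t ω => ⨆ s ∈ Finset.range (t + 1),
      ∑ A ∈ P, ENNReal.ofReal (p A) * EReal.exp (M.logLRIncr A s t ω))
    (Set.Ici (ENNReal.ofReal (Real.exp b))) 1

/-- The mixture CUSUM
`S̃_b = inf {t ≥ 1 : ∑_{A ∈ P} p_A exp(Ỹ_t^A) ≥ e^b}`. -/
def mixCusumTilde (P : Finset (Finset (Fin N))) (p : Finset (Fin N) → ℝ) (b : ℝ) :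
    Path E → WithTop ℕ :=
  hittingAfter (fun t ω =>
      ∑ A ∈ P, ENNReal.ofReal (p A) * EReal.exp (M.cusumYTilde A t ω))
    (Set.Ici (ENNReal.ofReal (Real.exp b))) 1

/-- A detection time as an element of `[0, ∞]`. -/
def timeValue (τ : WithTop ℕ) : ℝ≥0∞ := ENat.toENNReal τ

/-- The class `C_γ` of `(F_t)`-stopping times `T` with `E_∞[T] ≥ γ`. -/
def ruleClass (γ : ℝ) : Set (Path E → WithTop ℕ) :=
  {T | IsStoppingTime (filtration E) T ∧
    ENNReal.ofReal γ ≤ ∫⁻ ω, timeValue (T ω) ∂M.noChange}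

/-- Lorden's worst-case delay `J_A[T] = sup_{ν ≥ 0} ess sup E_ν^A[(T - ν)^+ | F_ν]`. -/
def lordenDelay (A : Finset (Fin N)) (T : Path E → WithTop ℕ) : ℝ≥0∞ :=
  ⨆ ν : ℕ, essSup
    (condLExp (filtration E ν) (M.change A ν) fun ω => timeValue (T ω) - (ν : ℝ≥0∞))
    (M.change A ν)

/-- The optimal performance `inf_{T ∈ C_γ} J_A[T]`. -/
def optimalDelay (A : Finset (Fin N)) (γ : ℝ) : ℝ≥0∞ :=
  ⨅ T ∈ M.ruleClass γ, M.lordenDelay A T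

/-- A detection rule, designed as `T γ` for each `γ ≥ 1`, is second-order asymptotically optimal
with respect to `P`: `T γ ∈ C_γ` for every `γ ≥ 1`, and, for every `A ∈ P`, as `γ → ∞` the delay
`J_A[T γ]` is finite and `J_A[T γ] - inf_{T' ∈ C_γ} J_A[T'] = O(1)`. -/
def SecondOrderOptimal (P : Finset (Finset (Fin N))) (T : ℝ → Path E → WithTop ℕ) : Prop :=
  (∀ γ : ℝ, 1 ≤ γ → T γ ∈ M.ruleClass γ) ∧
  ∀ A ∈ P, (∀ᶠ γ : ℝ in atTop, M.lordenDelay A (T γ) ≠ ∞) ∧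
    (fun γ : ℝ => (M.lordenDelay A (T γ)).toReal - (M.optimalDelay A γ).toReal)
      =O[atTop] fun _ => (1 : ℝ)

/-- For every `A ∈ P`, as `γ → ∞`, the delay `J_A[T γ]` is finite and equals
`log γ / I_A + O(1)`. -/
def HasSecondOrderDelay (P : Finset (Finset (Fin N))) (T : ℝ → Path E → WithTop ℕ) : Prop :=
  ∀ A ∈ P, (∀ᶠ γ : ℝ in atTop, M.lordenDelay A (T γ) ≠ ∞) ∧
    (fun γ : ℝ => (M.lordenDelay A (T γ)).toReal - Real.log γ / M.info A)
      =O[atTop] fun _ => (1 : ℝ)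

end

end SensorModel

/-! Both sides of the claim are compared with `log γ / I_A`. Only two features of the three rules
matter, and `IsCusumRule` isolates them: when such a rule stops (for `γ > 1`), the weighted
Shiryaev-Roberts statistic is at least `γ`; while it has not stopped, every weighted likelihood
ratio `p_A exp(Z_t^A - Z_s^A)` with `s < t` is below `γ`.

False alarms. Under `P_∞` the weighted Shiryaev-Roberts statistic minus time is a supermartingale,
so optional stopping gives `γ P_∞(T ≤ n) ≤ E_∞[T ∧ n]` (`mul_measure_compl_le_sum`). If `E_∞[T]` is
finite, letting `n → ∞` gives `E_∞[T] ≥ γ`.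

Upper bound on the delay. After a change, the rule stops no later than the walk `Z^A`, restarted at
`ν`, exceeds `y = log γ - log p_A`, whatever the past was. The walk has drift `I_A` and finite
variance, so its mean passage time is at most `y / I_A + O(1)`. This is proved with an explicit
potential (`exists_passagePotential`, `sum_measure_passage_le`).

Lower bound on the delay of every rule in the class. Let `W` be the CUSUM likelihood statistic, and
weight the conditional delays at `ν` by `(1 - W_ν)⁺`. A change of measure and summation over `ν`
give `N ≤ J D`, where `N` and `D` are the sums over `k` of `E_∞[max(W_k, 1); T > k]` and `E_∞[(1 -
W_k)⁺; T > k]` (`sum_setLIntegral_max_le`). The potential `√s` gives `D ≥ (1 - ρ) E_∞[T]`, with `ρ <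
1` the Hellinger affinity (`sum_measure_le_of_hellinger`); a potential built on `s log s` gives `c D
≤ e^c + I N` (`mul_sum_le_of_entropy`). With `c = log d`, `d ≤ D`, division by `D` yields `log d ≤ 1
+ I J`, and `d` can be a fixed multiple of `γ`. In the proof the sums over `k` are truncated at some
`n`, so that `D` is finite. -/

set_option linter.unusedSectionVars false

/-! ### Sequences of observations -/

namespace SequenceSpace

variable {X : Type*} [MeasurableSpace X]

/-- The σ-algebra on sequences generated by the first `t` coordinates. -/
@[reducible]
def past (X : Type*) [MeasurableSpace X] (t : ℕ) : MeasurableSpace (ℕ → X) :=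
  ⨆ (u : ℕ) (_ : u < t), MeasurableSpace.comap (fun ω : ℕ → X => ω u) inferInstance

lemma past_le (t : ℕ) : past X t ≤ MeasurableSpace.pi :=
  iSup₂_le fun u _ => (measurable_pi_apply u).comap_le

lemma past_mono {s t : ℕ} (h : s ≤ t) : past X s ≤ past X t :=
  iSup₂_le fun u hu => le_iSup₂ (f := fun (u : ℕ) (_ : u < t) =>
    MeasurableSpace.comap (fun ω : ℕ → X => ω u) inferInstance) u (lt_of_lt_of_le hu h)

lemma measurable_eval_past {u t : ℕ} (h : u < t) : Measurable[past X t] (fun ω : ℕ → X => ω u) :=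
  Measurable.of_comap_le <| le_iSup₂ (f := fun (u : ℕ) (_ : u < t) =>
    MeasurableSpace.comap (fun ω : ℕ → X => ω u) inferInstance) u h

lemma past_le_comap_restrict (t : ℕ) :
    past X t ≤ MeasurableSpace.comap (fun (ω : ℕ → X) (u : Set.Iio t) => ω u)
      MeasurableSpace.pi := by
  refine iSup₂_le fun u hu => ?_
  have : (fun ω : ℕ → X => ω u) =
      (fun v : Set.Iio t → X => v ⟨u, hu⟩) ∘ (fun (ω : ℕ → X) (u : Set.Iio t) => ω u) := rfl
  rw [this, ← MeasurableSpace.comap_comp]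
  exact MeasurableSpace.comap_mono (measurable_pi_apply _).comap_le

/-- An event of the first `t` coordinates, which are indexed by `0, …, t - 1`, does not see
coordinate `t`. -/
lemma update_mem_iff {t : ℕ} {s : Set (ℕ → X)} (hs : MeasurableSet[past X t] s)
    (ω : ℕ → X) (x : X) : Function.update ω t x ∈ s ↔ ω ∈ s := by
  obtain ⟨s', -, rfl⟩ := past_le_comap_restrict t s hs
  have : (fun u : Set.Iio t => Function.update ω t x u) = fun u : Set.Iio t => ω u := by
    funext u
    exact Function.update_of_ne (ne_of_lt u.2) _ _
  simp only [Set.mem_preimage, this]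

lemma apply_update {β : Type*} [MeasurableSpace β] [MeasurableSingletonClass β] {t : ℕ}
    {f : (ℕ → X) → β} (hf : Measurable[past X t] f) (ω : ℕ → X) (x : X) :
    f (Function.update ω t x) = f ω :=
  (update_mem_iff (hf (measurableSet_singleton (f ω))) ω x).2 rfl

lemma measurable_update_past (t : ℕ) :
    @Measurable _ _ (@Prod.instMeasurableSpace _ _ (past X t) _) (past X (t + 1))
      (fun p : (ℕ → X) × X => Function.update p.1 t p.2) := by
  refine Measurable.of_le_map (iSup₂_le fun u hu => ?_)
  refine MeasurableSpace.comap_le_iff_le_map.1 ?_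
  rw [MeasurableSpace.comap_comp]
  refine @Measurable.comap_le ((ℕ → X) × X) X (@Prod.instMeasurableSpace _ _ (past X t) ‹_›) ‹_› _ ?_
  by_cases h : u = t
  · subst h
    simp only [Function.comp_def, Function.update_self]
    exact @measurable_snd (ℕ → X) X (past X u) ‹_›
  · have hu' : u < t := lt_of_le_of_ne (Nat.lt_succ_iff.1 hu) h
    simp only [Function.comp_def, Function.update_of_ne h]
    exact (measurable_eval_past hu').comp (@measurable_fst (ℕ → X) X (past X t) ‹_›)

lemma measurable_update_pi (t : ℕ) :
    Measurable (fun p : (ℕ → X) × X => Function.update p.1 t p.2) := by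
  refine measurable_pi_lambda _ fun u => ?_
  by_cases h : u = t
  · subst h; simpa using measurable_snd
  · simp only [Function.update_of_ne h]
    exact (measurable_pi_apply u).comp measurable_fst

/-! ### Resampling one coordinate of a product measure. -/

section Product

variable (μ : ℕ → Measure X) [∀ u, IsProbabilityMeasure (μ u)]

lemma map_update_infinitePi (t : ℕ) :
    ((Measure.infinitePi μ).prod (μ t)).map
      (fun p : (ℕ → X) × X => Function.update p.1 t p.2) = Measure.infinitePi μ := by
  refine Measure.eq_infinitePi μ fun s A hA => ?_
  rw [Measure.map_apply (measurable_update_pi t)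
    (MeasurableSet.pi s.countable_toSet fun i _ => hA i)]
  have : (fun p : (ℕ → X) × X => Function.update p.1 t p.2) ⁻¹' ((s : Set ℕ).pi A) =
      (((s.erase t : Finset ℕ) : Set ℕ).pi A) ×ˢ (if t ∈ s then A t else Set.univ) := by
    ext ⟨ω, x⟩
    simp only [Set.mem_preimage, Set.mem_pi, Set.mem_prod, Finset.mem_coe, Finset.mem_erase]
    constructor
    · intro h
      refine ⟨fun i hi => ?_, ?_⟩
      · simpa [Function.update_of_ne hi.1] using h i hi.2
      · split_ifs with hts
        · simpa using h t hts
        · trivial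
    · rintro ⟨h1, h2⟩ i hi
      by_cases hit : i = t
      · subst hit; simpa [hi] using h2
      · simpa [Function.update_of_ne hit] using h1 i ⟨hit, hi⟩
  rw [this, Measure.prod_prod, Measure.infinitePi_pi μ fun i _ => hA i]
  by_cases hts : t ∈ s
  · rw [if_pos hts, Finset.prod_erase_mul _ _ hts]
  · rw [if_neg hts, measure_univ, mul_one, Finset.erase_eq_of_notMem hts]

lemma lintegral_update (t : ℕ) {g : (ℕ → X) → ℝ≥0∞} (hg : Measurable g) :
    ∫⁻ ω, g ω ∂Measure.infinitePi μ =
      ∫⁻ ω, ∫⁻ x, g (Function.update ω t x) ∂μ t ∂Measure.infinitePi μ := by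
  conv_lhs => rw [← map_update_infinitePi μ t]
  rw [lintegral_map hg (measurable_update_pi t),
    lintegral_prod (fun p : (ℕ → X) × X => g (Function.update p.1 t p.2))
      (hg.comp (measurable_update_pi t)).aemeasurable]

/-- Integrating out coordinate `t` plays the role of conditioning on `past X t`; every one-step
drift estimate below passes through this identity. -/
lemma setLIntegral_update (t : ℕ) {s : Set (ℕ → X)} (hs : MeasurableSet[past X t] s)
    {g : (ℕ → X) → ℝ≥0∞} (hg : Measurable g) :
    ∫⁻ ω in s, g ω ∂Measure.infinitePi μ =
      ∫⁻ ω in s, ∫⁻ x, g (Function.update ω t x) ∂μ t ∂Measure.infinitePi μ := by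
  have hs' := past_le t s hs
  rw [← lintegral_indicator hs', ← lintegral_indicator hs',
    lintegral_update μ t (hg.indicator hs')]
  refine lintegral_congr fun ω => ?_
  by_cases h : ω ∈ s
  · simp [Set.indicator, update_mem_iff hs, h]
  · simp [Set.indicator, update_mem_iff hs, h]

end Product

/-- Independent observations, with law `μ₀` before time `ν` and `μ₁` from then on. -/
noncomputable def changeLaw (μ₀ μ₁ : Measure X) (ν : ℕ) : Measure (ℕ → X) :=
  Measure.infinitePi fun u => if u < ν then μ₀ else μ₁

instance (μ₀ μ₁ : Measure X) [IsProbabilityMeasure μ₀] [IsProbabilityMeasure μ₁] (ν u : ℕ) :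
    IsProbabilityMeasure (if u < ν then μ₀ else μ₁) := by
  split_ifs <;> infer_instance

instance (μ₀ μ₁ : Measure X) [IsProbabilityMeasure μ₀] [IsProbabilityMeasure μ₁] (ν : ℕ) :
    IsProbabilityMeasure (changeLaw μ₀ μ₁ ν) := by
  unfold changeLaw; infer_instance

/-- Induction on `t`, integrating out the last coordinate: before `ν` both laws agree there and the
product is empty, afterwards the density contributes one more factor. -/
lemma lintegral_changeLaw {μ : Measure X} [IsProbabilityMeasure μ] {L : X → ℝ≥0∞}
    (hL : Measurable L) [IsProbabilityMeasure (μ.withDensity L)] (ν t : ℕ)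
    {g : (ℕ → X) → ℝ≥0∞} (hg : Measurable[past X t] g) :
    ∫⁻ ω, g ω ∂changeLaw μ (μ.withDensity L) ν =
      ∫⁻ ω, g ω * ∏ u ∈ Finset.Ico ν t, L (ω u) ∂Measure.infinitePi fun _ => μ := by
  induction t generalizing g with
  | zero =>
    have : past X 0 = ⊥ := by simp [past]
    rw [this] at hg
    have : Nonempty X := nonempty_of_isProbabilityMeasure μ
    obtain ⟨c, rfl⟩ := eq_const_of_measurable_bot hg
    simp
  | succ t ih =>
    have hg' := hg.mono (past_le (t + 1)) le_rfl
    have hprod : Measurable fun ω : ℕ → X => ∏ u ∈ Finset.Ico ν (t + 1), L (ω u) := by fun_prop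
    have hG : ∀ (m : Measure X) [SFinite m],
        Measurable[past X t] fun ω => ∫⁻ x, g (Function.update ω t x) ∂m := by
      intro m _
      exact @Measurable.lintegral_prod_right' _ _ (past X t) _ m _ _
        (hg.comp (measurable_update_past t))
    rw [changeLaw, lintegral_update _ t hg', ← changeLaw, ih (hG _),
      lintegral_update _ t
        (g := fun ω => g ω * ∏ u ∈ Finset.Ico ν (t + 1), L (ω u)) (hg'.mul hprod)]
    refine lintegral_congr fun ω => ?_
    have hgm : Measurable fun x => g (Function.update ω t x) :=
      hg'.comp ((measurable_update_pi t).comp measurable_prodMk_left)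
    by_cases h : t < ν
    · simp [h, Finset.Ico_eq_empty_of_le h.le]
    · have h' : ν ≤ t := not_lt.1 h
      have hne : ∀ u ∈ Finset.Ico ν t, ∀ x, Function.update ω t x u = ω u := fun u hu x =>
        Function.update_of_ne (Finset.mem_Ico.1 hu).2.ne _ _
      simp only [h, if_false, Finset.prod_Ico_succ_top h', Function.update_self]
      rw [lintegral_withDensity_eq_lintegral_mul _ hL hgm, ← lintegral_mul_const _ (hL.mul hgm)]
      refine lintegral_congr fun x => ?_
      have hprod' : ∏ u ∈ Finset.Ico ν t, L (Function.update ω t x u) =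
          ∏ u ∈ Finset.Ico ν t, L (ω u) :=
        Finset.prod_congr rfl fun u hu => by rw [hne u hu x]
      simp only [Pi.mul_apply, hprod']
      ring

lemma setLIntegral_changeLaw {μ : Measure X} [IsProbabilityMeasure μ] {L : X → ℝ≥0∞}
    (hL : Measurable L) [IsProbabilityMeasure (μ.withDensity L)] (ν t : ℕ)
    {s : Set (ℕ → X)} (hs : MeasurableSet[past X t] s)
    {g : (ℕ → X) → ℝ≥0∞} (hg : Measurable[past X t] g) :
    ∫⁻ ω in s, g ω ∂changeLaw μ (μ.withDensity L) ν =
      ∫⁻ ω in s, g ω * ∏ u ∈ Finset.Ico ν t, L (ω u) ∂Measure.infinitePi fun _ => μ := by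
  have hs' := past_le t s hs
  rw [← lintegral_indicator hs', ← lintegral_indicator hs',
    lintegral_changeLaw hL ν t (hg.indicator hs)]
  refine lintegral_congr fun ω => ?_
  by_cases h : ω ∈ s <;> simp [h]

end SequenceSpace

/-! ### Lower bound for the worst-case delay -/

namespace SequenceSpace

variable {X : Type*} [MeasurableSpace X]

open scoped Classical in
/-- The CUSUM statistic with likelihood ratio `h`, started at `0` and frozen when the sequence
leaves the sets `B 0, B 1, …`. -/
noncomputable def frozenCusum (h : X → ℝ) (B : ℕ → Set (ℕ → X)) : ℕ → (ℕ → X) → ℝ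
  | 0 => fun _ => 0
  | k + 1 => fun ω =>
      if ω ∈ B k then max (frozenCusum h B k ω) 1 * h (ω k) else frozenCusum h B k ω

variable {h : X → ℝ} {B : ℕ → Set (ℕ → X)}

lemma frozenCusum_succ_of_mem {k : ℕ} {ω : ℕ → X} (hω : ω ∈ B k) :
    frozenCusum h B (k + 1) ω = max (frozenCusum h B k ω) 1 * h (ω k) := by
  simp [frozenCusum, hω]

lemma frozenCusum_succ_of_notMem {k : ℕ} {ω : ℕ → X} (hω : ω ∉ B k) :
    frozenCusum h B (k + 1) ω = frozenCusum h B k ω := by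
  simp [frozenCusum, hω]

lemma frozenCusum_nonneg (h0 : ∀ x, 0 ≤ h x) (k : ℕ) (ω : ℕ → X) : 0 ≤ frozenCusum h B k ω := by
  induction k with
  | zero => simp [frozenCusum]
  | succ k ih =>
    by_cases hω : ω ∈ B k
    · rw [frozenCusum_succ_of_mem hω]
      exact mul_nonneg (le_max_of_le_right zero_le_one) (h0 _)
    · rwa [frozenCusum_succ_of_notMem hω]

lemma measurable_frozenCusum (hm : Measurable h) (hB : ∀ t, MeasurableSet[past X t] (B t)) (k : ℕ) :
    Measurable[past X k] (frozenCusum h B k) := by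
  induction k with
  | zero => exact measurable_const
  | succ k ih =>
    have ih' := ih.mono (past_mono k.le_succ) le_rfl
    exact Measurable.ite (past_mono k.le_succ _ (hB k))
      ((ih'.max measurable_const).mul (hm.comp (measurable_eval_past k.lt_succ_self))) ih'

/-- By induction the terms `ν ≤ t`, carried to time `t + 1`, add up to `max(W_t, 1) h = W_{t+1}`;
the new term `(1 - W_{t+1})⁺` raises this to `max(W_{t+1}, 1)`. The weights `(1 - W_ν)⁺` are chosen
for this telescoping. -/
lemma sum_prod_eq_max_frozenCusum (hanti : Antitone B) (t : ℕ) {ω : ℕ → X} (hω : ω ∈ B t) :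
    ∑ ν ∈ Finset.range (t + 1),
      max (1 - frozenCusum h B ν ω) 0 * ∏ u ∈ Finset.Ico ν t, h (ω u) =
      max (frozenCusum h B t ω) 1 := by
  have key : ∀ a : ℝ, max (1 - a) 0 + a = max a 1 := fun a => by
    rcases le_total a 1 with ha | ha
    · rw [max_eq_left (by linarith), max_eq_right ha]; ring
    · rw [max_eq_right (by linarith), max_eq_left ha]; ring
  induction t with
  | zero => simp [frozenCusum]
  | succ t ih =>
    have hω' : ω ∈ B t := hanti t.le_succ hω
    rw [Finset.sum_range_succ, Finset.Ico_self, Finset.prod_empty, mul_one]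
    have : ∑ ν ∈ Finset.range (t + 1),
        max (1 - frozenCusum h B ν ω) 0 * ∏ u ∈ Finset.Ico ν (t + 1), h (ω u) =
        frozenCusum h B (t + 1) ω := by
      rw [frozenCusum_succ_of_mem hω', ← ih hω', Finset.sum_mul]
      refine Finset.sum_congr rfl fun ν hν => ?_
      rw [Finset.prod_Ico_succ_top (Nat.lt_succ_iff.1 (Finset.mem_range.1 hν)), mul_assoc]
    rw [this, add_comm, ← key (frozenCusum h B (t + 1) ω), add_comm]

/-! ### Potential-function inequalities for the CUSUM statistic without change. -/

section Bounds

variable {μ : Measure X} [IsProbabilityMeasure μ]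

/-- Optional stopping in additive form. On `B k` the statistic makes one CUSUM step and `hstep`
applies; off `B k` it is frozen and the potential is unchanged. Working in `ℝ≥0∞` with `α` and `β`
on opposite sides avoids subtraction and integrability conditions. -/
lemma lintegral_potential_le (hm : Measurable h) (h0 : ∀ x, 0 ≤ h x)
    (hB : ∀ t, MeasurableSet[past X t] (B t)) {V α β : ℝ → ℝ≥0∞} (hV : Measurable V)
    (hα : Measurable α)
    (hstep : ∀ s, 0 ≤ s → ∫⁻ x, V (max s 1 * h x) ∂μ + α s ≤ V s + β s) (n : ℕ) :
    ∫⁻ ω, V (frozenCusum h B n ω) ∂Measure.infinitePi (fun _ => μ) +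
      ∑ k ∈ Finset.range n, ∫⁻ ω in B k, α (frozenCusum h B k ω) ∂Measure.infinitePi (fun _ => μ) ≤
    V 0 + ∑ k ∈ Finset.range n,
      ∫⁻ ω in B k, β (frozenCusum h B k ω) ∂Measure.infinitePi (fun _ => μ) := by
  set Q : Measure (ℕ → X) := Measure.infinitePi (fun _ => μ) with hQ
  have hW : ∀ k, Measurable (frozenCusum h B k) := fun k =>
    (measurable_frozenCusum hm hB k).mono (past_le k) le_rfl
  have hB' : ∀ t, MeasurableSet (B t) := fun t => past_le t _ (hB t)
  have one : ∀ k, ∫⁻ ω, V (frozenCusum h B (k + 1) ω) ∂Q +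
      ∫⁻ ω in B k, α (frozenCusum h B k ω) ∂Q ≤
      ∫⁻ ω, V (frozenCusum h B k ω) ∂Q + ∫⁻ ω in B k, β (frozenCusum h B k ω) ∂Q := by
    intro k
    rw [← lintegral_add_compl (fun ω => V (frozenCusum h B (k + 1) ω)) (hB' k),
      ← lintegral_add_compl (fun ω => V (frozenCusum h B k ω)) (hB' k),
      setLIntegral_congr_fun (f := fun ω => V (frozenCusum h B (k + 1) ω))
        (g := fun ω => V (frozenCusum h B k ω)) (hB' k).compl
        (fun ω hω => by simp only [frozenCusum_succ_of_notMem hω])]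
    have hstepB : ∫⁻ ω in B k, V (frozenCusum h B (k + 1) ω) ∂Q =
        ∫⁻ ω in B k, ∫⁻ x, V (max (frozenCusum h B k ω) 1 * h x) ∂μ ∂Q := by
      rw [hQ, setLIntegral_update (fun _ => μ) k (hB k)
        (g := fun ω => V (frozenCusum h B (k + 1) ω)) (hV.comp (hW (k + 1)))]
      refine setLIntegral_congr_fun (hB' k) fun ω hω => lintegral_congr fun x => ?_
      rw [frozenCusum_succ_of_mem ((update_mem_iff (hB k) ω x).2 hω),
        apply_update (measurable_frozenCusum hm hB k), Function.update_self]
    have hle : ∫⁻ ω in B k, V (frozenCusum h B (k + 1) ω) ∂Q +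
        ∫⁻ ω in B k, α (frozenCusum h B k ω) ∂Q ≤
        ∫⁻ ω in B k, V (frozenCusum h B k ω) ∂Q + ∫⁻ ω in B k, β (frozenCusum h B k ω) ∂Q := by
      have hαk : Measurable fun ω => α (frozenCusum h B k ω) := hα.comp (hW k)
      have hVk : Measurable fun ω => V (frozenCusum h B k ω) := hV.comp (hW k)
      rw [hstepB, ← lintegral_add_right _ hαk, ← lintegral_add_left hVk]
      exact lintegral_mono fun ω => hstep _ (frozenCusum_nonneg h0 k ω)
    calc _ = (∫⁻ ω in B k, V (frozenCusum h B (k + 1) ω) ∂Q +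
        ∫⁻ ω in B k, α (frozenCusum h B k ω) ∂Q) +
          ∫⁻ ω in (B k)ᶜ, V (frozenCusum h B k ω) ∂Q := by ring
      _ ≤ _ := add_le_add_left hle _
      _ = _ := by ring
  induction n with
  | zero => simp [frozenCusum]
  | succ n ih =>
    rw [Finset.sum_range_succ, Finset.sum_range_succ]
    calc _ = (∫⁻ ω, V (frozenCusum h B (n + 1) ω) ∂Q +
          ∫⁻ ω in B n, α (frozenCusum h B n ω) ∂Q) +
          ∑ k ∈ Finset.range n, ∫⁻ ω in B k, α (frozenCusum h B k ω) ∂Q := by ring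
      _ ≤ _ := add_le_add_left (one n) _
      _ = (∫⁻ ω, V (frozenCusum h B n ω) ∂Q +
          ∑ k ∈ Finset.range n, ∫⁻ ω in B k, α (frozenCusum h B k ω) ∂Q) +
          ∫⁻ ω in B n, β (frozenCusum h B n ω) ∂Q := by ring
      _ ≤ _ := add_le_add_left ih _
      _ = _ := by ring

/-- Weighting the conditional delays by `(1 - W_ν)⁺` bounds the worst-case delay from below by a
ratio of expectations without change. -/
lemma sum_setLIntegral_max_le (hm : Measurable h) (h0 : ∀ x, 0 ≤ h x)
    [IsProbabilityMeasure (μ.withDensity fun x => ENNReal.ofReal (h x))]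
    (hB : ∀ t, MeasurableSet[past X t] (B t)) (hanti : Antitone B) {J : ℝ≥0∞} (n : ℕ)
    (hJ : ∀ ν, ∀ w : (ℕ → X) → ℝ≥0∞, Measurable[past X ν] w →
      ∑ t ∈ Finset.Ico ν n, ∫⁻ ω in B t, w ω
          ∂changeLaw μ (μ.withDensity fun x => ENNReal.ofReal (h x)) ν ≤
        J * ∫⁻ ω, w ω ∂changeLaw μ (μ.withDensity fun x => ENNReal.ofReal (h x)) ν) :
    ∑ k ∈ Finset.range n, ∫⁻ ω in B k, ENNReal.ofReal (max (frozenCusum h B k ω) 1)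
        ∂Measure.infinitePi (fun _ => μ) ≤
      J * ∑ k ∈ Finset.range n, ∫⁻ ω in B k, ENNReal.ofReal (1 - frozenCusum h B k ω)
        ∂Measure.infinitePi (fun _ => μ) := by
  have hL : Measurable fun x => ENNReal.ofReal (h x) := hm.ennreal_ofReal
  have hB' : ∀ t, MeasurableSet (B t) := fun t => past_le t _ (hB t)
  have hW : ∀ k, Measurable[past X k] fun ω => ENNReal.ofReal (1 - frozenCusum h B k ω) :=
    fun k => (measurable_const.sub (measurable_frozenCusum hm hB k)).ennreal_ofReal
  have hW' := fun k => (hW k).mono (past_le k) le_rfl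
  have step : ∀ ν, ∑ t ∈ Finset.Ico ν n, ∫⁻ ω in B t,
      ENNReal.ofReal (1 - frozenCusum h B ν ω) * ∏ u ∈ Finset.Ico ν t, ENNReal.ofReal (h (ω u))
        ∂Measure.infinitePi (fun _ => μ) ≤
      J * ∫⁻ ω in B ν, ENNReal.ofReal (1 - frozenCusum h B ν ω)
        ∂Measure.infinitePi (fun _ => μ) := by
    intro ν
    -- The weight is `(1 - W_ν)⁺` restricted to `B ν`; the restriction costs nothing on the left,
    -- since `B t ⊆ B ν` for `t ≥ ν`.
    refine le_trans (le_of_eq ?_) ((hJ ν ((B ν).indicator fun ω =>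
      ENNReal.ofReal (1 - frozenCusum h B ν ω)) ((hW ν).indicator (hB ν))).trans (le_of_eq ?_))
    · refine Finset.sum_congr rfl fun t ht => ?_
      have hνt := (Finset.mem_Ico.1 ht).1
      rw [← setLIntegral_changeLaw hL ν t (hB t) ((hW ν).mono (past_mono hνt) le_rfl)]
      refine setLIntegral_congr_fun (hB' t) fun ω hω => ?_
      simp [Set.indicator_of_mem (hanti hνt hω)]
    · rw [lintegral_indicator (hB' ν), setLIntegral_changeLaw hL ν ν (hB ν) (hW ν)]
      simp
  rw [Finset.mul_sum]
  refine le_trans (le_of_eq ?_) (Finset.sum_le_sum fun ν _ => step ν)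
  rw [Finset.sum_comm' (s' := fun t => Finset.range (t + 1)) (t' := Finset.range n)
    (fun x y => by simp only [Finset.mem_range, Finset.mem_Ico]; omega)]
  refine Finset.sum_congr rfl fun t _ => ?_
  have hprod : ∀ ν, Measurable fun ω => ENNReal.ofReal (1 - frozenCusum h B ν ω) *
      ∏ u ∈ Finset.Ico ν t, ENNReal.ofReal (h (ω u)) := fun ν => (hW' ν).mul (by fun_prop)
  rw [← lintegral_finsetSum _ fun ν _ => hprod ν]
  refine setLIntegral_congr_fun (hB' t) fun ω hω => ?_
  rw [← sum_prod_eq_max_frozenCusum hanti t hω, ENNReal.ofReal_sum_of_nonneg fun ν _ =>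
    mul_nonneg (le_max_right _ _) (Finset.prod_nonneg fun u _ => h0 _)]
  refine Finset.sum_congr rfl fun ν _ => ?_
  rw [ENNReal.ofReal_mul (le_max_right _ _), ENNReal.ofReal_prod_of_nonneg fun u _ => h0 _,
    ENNReal.ofReal_max, ENNReal.ofReal_zero, max_eq_left (zero_le)]

/-- Potential `V(s) = √s`, with mean `ρ √max(s, 1)` after one step. For `s ≤ 1` the drift inequality
reduces to `s ≤ √s`, for `s ≥ 1` to `1 ≤ √s`; and `V(0) = 0`. -/
lemma sum_measure_le_of_hellinger (hm : Measurable h) (h0 : ∀ x, 0 ≤ h x)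
    (hB : ∀ t, MeasurableSet[past X t] (B t)) {ρ : ℝ} (hρ0 : 0 ≤ ρ) (hρ1 : ρ ≤ 1)
    (hρ : ∫⁻ x, ENNReal.ofReal √(h x) ∂μ = ENNReal.ofReal ρ) (n : ℕ) :
    ENNReal.ofReal (1 - ρ) * ∑ k ∈ Finset.range n, Measure.infinitePi (fun _ => μ) (B k) ≤
      ∑ k ∈ Finset.range n, ∫⁻ ω in B k, ENNReal.ofReal (1 - frozenCusum h B k ω)
        ∂Measure.infinitePi (fun _ => μ) := by
  have key := lintegral_potential_le (μ := μ) hm h0 hB (V := fun s => ENNReal.ofReal √s)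
    (α := fun _ => ENNReal.ofReal (1 - ρ)) (β := fun s => ENNReal.ofReal (1 - s))
    (by fun_prop) measurable_const (fun s hs => by
      have hm1 : (1 : ℝ) ≤ √(max s 1) := by
        rw [Real.one_le_sqrt]; exact le_max_right _ _
      simp only [Real.sqrt_mul (le_max_of_le_right zero_le_one : (0 : ℝ) ≤ max s 1),
        ENNReal.ofReal_mul (Real.sqrt_nonneg _)]
      rw [lintegral_const_mul _ (by fun_prop), hρ, ← ENNReal.ofReal_mul (Real.sqrt_nonneg _),
        ← ENNReal.ofReal_add (by positivity) (by linarith)]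
      rcases le_total s 1 with h1 | h1
      · rw [← ENNReal.ofReal_add (by positivity) (by linarith), max_eq_right h1]
        refine ENNReal.ofReal_le_ofReal ?_
        have : s ≤ √s := by
          rw [Real.le_sqrt hs hs]; nlinarith
        simp; linarith
      · rw [max_eq_left h1] at hm1 ⊢
        refine (ENNReal.ofReal_le_ofReal ?_).trans le_self_add
        nlinarith) n
  simp only [lintegral_const, Measure.restrict_apply_univ, Real.sqrt_zero, ENNReal.ofReal_zero,
    zero_add, ← Finset.mul_sum] at key
  exact le_add_self.trans key

/-- Convexity: `(c + 1) s - e^c` is the tangent of `s log s` at `s = e^c`. -/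
lemma tangent_le_mul_log {s c : ℝ} (hs : 0 ≤ s) : 0 ≤ s * Real.log s - (c + 1) * s + Real.exp c := by
  rcases hs.eq_or_lt with rfl | hs
  · simp [Real.exp_nonneg]
  · have h1 := Real.add_one_le_exp (c - Real.log s)
    rw [Real.exp_sub, Real.exp_log hs, le_div_iff₀ hs] at h1
    nlinarith

/-- Potential `V(s) = s log s - (c + 1) s + e^c`, nonnegative with `V(0) = e^c`. Its mean after one
step from `s` is `V(m) + m I`, `m = max(s, 1)`. For `s ≥ 1` the drift relation is an equality, and
for `s ≤ 1` it reduces to `s - 1 ≤ s log s`. -/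
lemma mul_sum_le_of_entropy (hm : Measurable h) (h0 : ∀ x, 0 ≤ h x)
    (hB : ∀ t, MeasurableSet[past X t] (B t)) (hint : Integrable h μ) (hone : ∫ x, h x ∂μ = 1)
    (hlog : Integrable (fun x => h x * Real.log (h x)) μ) {I : ℝ} (hI : 0 ≤ I)
    (hentropy : ∫ x, h x * Real.log (h x) ∂μ = I) {c : ℝ} (hc : 0 ≤ c) (n : ℕ) :
    ENNReal.ofReal c * ∑ k ∈ Finset.range n, ∫⁻ ω in B k,
        ENNReal.ofReal (1 - frozenCusum h B k ω) ∂Measure.infinitePi (fun _ => μ) ≤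
      ENNReal.ofReal (Real.exp c) + ENNReal.ofReal I * ∑ k ∈ Finset.range n, ∫⁻ ω in B k,
        ENNReal.ofReal (max (frozenCusum h B k ω) 1) ∂Measure.infinitePi (fun _ => μ) := by
  have key := lintegral_potential_le (μ := μ) hm h0 hB
    (V := fun s => ENNReal.ofReal (s * Real.log s - (c + 1) * s + Real.exp c))
    (α := fun s => ENNReal.ofReal c * ENNReal.ofReal (1 - s))
    (β := fun s => ENNReal.ofReal I * ENNReal.ofReal (max s 1))
    (by fun_prop) (by fun_prop) (fun s hs => by
      have hm1 : (1 : ℝ) ≤ max s 1 := le_max_right _ _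
      have hm0 : (0 : ℝ) < max s 1 := by linarith
      have hexp : ∀ x, max s 1 * h x * Real.log (max s 1 * h x) - (c + 1) * (max s 1 * h x) +
          Real.exp c = (max s 1 * (h x * Real.log (h x)) +
            (max s 1 * Real.log (max s 1) - (c + 1) * max s 1) * h x) + Real.exp c := fun x => by
        rcases (h0 x).eq_or_lt with hx | hx
        · simp [← hx]
        · rw [Real.log_mul hm0.ne' hx.ne']; ring
      have hint1 : Integrable (fun x => max s 1 * (h x * Real.log (h x))) μ := hlog.const_mul _
      have hint2 : Integrable (fun x =>
        (max s 1 * Real.log (max s 1) - (c + 1) * max s 1) * h x) μ := hint.const_mul _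
      rw [← ofReal_integral_eq_lintegral_ofReal (by
        simp only [hexp]
        exact (hint1.add hint2).add (integrable_const _))
        (ae_of_all _ fun x => tangent_le_mul_log (mul_nonneg hm0.le (h0 x)))]
      simp only [hexp]
      rw [integral_add (f := fun x => max s 1 * (h x * Real.log (h x)) +
            (max s 1 * Real.log (max s 1) - (c + 1) * max s 1) * h x)
          (hint1.add hint2) (integrable_const _), integral_add hint1 hint2,
        integral_const_mul, integral_const_mul, hentropy, hone]
      simp only [integral_const, probReal_univ, smul_eq_mul, one_mul, mul_one]
      rw [← ENNReal.ofReal_mul hI, ← ENNReal.ofReal_add (tangent_le_mul_log hs) (by positivity),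
        ← ENNReal.ofReal_mul hc]
      have hpos : 0 ≤ max s 1 * I +
          (max s 1 * Real.log (max s 1) - (c + 1) * max s 1) + Real.exp c := by
        have := tangent_le_mul_log (c := c) hm0.le
        have := mul_nonneg hm0.le hI
        linarith
      rcases le_total s 1 with h1 | h1
      · rw [← ENNReal.ofReal_add hpos (mul_nonneg hc (by linarith)), max_eq_right h1]
        refine ENNReal.ofReal_le_ofReal ?_
        have : s - 1 ≤ s * Real.log s := by
          have := tangent_le_mul_log (c := 0) hs
          simp at this; linarith
        simp only [Real.log_one]
        nlinarith
      · rw [ENNReal.ofReal_of_nonpos (mul_nonpos_of_nonneg_of_nonpos hc (by linarith)), add_zero,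
          max_eq_left h1]
        exact ENNReal.ofReal_le_ofReal (by linarith)) n
  have hW : ∀ k, Measurable (frozenCusum h B k) := fun k =>
    (measurable_frozenCusum hm hB k).mono (past_le k) le_rfl
  have e1 : ∀ k, ∫⁻ ω in B k, ENNReal.ofReal c * ENNReal.ofReal (1 - frozenCusum h B k ω)
      ∂Measure.infinitePi (fun _ => μ) = ENNReal.ofReal c * ∫⁻ ω in B k,
        ENNReal.ofReal (1 - frozenCusum h B k ω) ∂Measure.infinitePi (fun _ => μ) := fun k =>
    lintegral_const_mul _ (measurable_const.sub (hW k)).ennreal_ofReal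
  have e2 : ∀ k, ∫⁻ ω in B k, ENNReal.ofReal I * ENNReal.ofReal (max (frozenCusum h B k ω) 1)
      ∂Measure.infinitePi (fun _ => μ) = ENNReal.ofReal I * ∫⁻ ω in B k,
        ENNReal.ofReal (max (frozenCusum h B k ω) 1) ∂Measure.infinitePi (fun _ => μ) := fun k =>
    lintegral_const_mul _ ((hW k).max measurable_const).ennreal_ofReal
  simp only [e1, e2, ← Finset.mul_sum] at key
  simpa using le_add_self.trans key

/-- Lower bound for the worst-case delay in terms of the mean time to false alarm. -/
lemma log_le_one_add_mul_delay (hm : Measurable h) (h0 : ∀ x, 0 ≤ h x)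
    [IsProbabilityMeasure (μ.withDensity fun x => ENNReal.ofReal (h x))]
    (hB : ∀ t, MeasurableSet[past X t] (B t)) (hanti : Antitone B)
    (hint : Integrable h μ) (hone : ∫ x, h x ∂μ = 1)
    (hlog : Integrable (fun x => h x * Real.log (h x)) μ) {I : ℝ} (hI : 0 ≤ I)
    (hentropy : ∫ x, h x * Real.log (h x) ∂μ = I) {ρ : ℝ} (hρ0 : 0 ≤ ρ) (hρ1 : ρ ≤ 1)
    (hρ : ∫⁻ x, ENNReal.ofReal √(h x) ∂μ = ENNReal.ofReal ρ) {J : ℝ≥0∞} (n : ℕ)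
    (hJ : ∀ ν, ∀ w : (ℕ → X) → ℝ≥0∞, Measurable[past X ν] w →
      ∑ t ∈ Finset.Ico ν n, ∫⁻ ω in B t, w ω
          ∂changeLaw μ (μ.withDensity fun x => ENNReal.ofReal (h x)) ν ≤
        J * ∫⁻ ω, w ω ∂changeLaw μ (μ.withDensity fun x => ENNReal.ofReal (h x)) ν)
    {d : ℝ} (hd : 1 ≤ d) (hdn : ENNReal.ofReal d ≤ ENNReal.ofReal (1 - ρ) *
      ∑ k ∈ Finset.range n, Measure.infinitePi (fun _ => μ) (B k)) :
    ENNReal.ofReal (Real.log d) ≤ 1 + ENNReal.ofReal I * J := by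
  set D := ∑ k ∈ Finset.range n, ∫⁻ ω in B k, ENNReal.ofReal (1 - frozenCusum h B k ω)
    ∂Measure.infinitePi (fun _ => μ) with hD
  have hdD : ENNReal.ofReal d ≤ D :=
    hdn.trans (sum_measure_le_of_hellinger hm h0 hB hρ0 hρ1 hρ n)
  have hDpos : D ≠ 0 := (lt_of_lt_of_le (ENNReal.ofReal_pos.2 (by linarith)) hdD).ne'
  -- Truncation at `n` makes `D` finite, so that it can be cancelled at the end.
  have hDtop : D ≠ ∞ := by
    refine ENNReal.sum_ne_top.2 fun k _ => ne_top_of_le_ne_top ENNReal.one_ne_top ?_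
    calc _ ≤ ∫⁻ ω in B k, 1 ∂Measure.infinitePi (fun _ => μ) := lintegral_mono fun ω => by
          rw [← ENNReal.ofReal_one]
          exact ENNReal.ofReal_le_ofReal (by linarith [frozenCusum_nonneg (B := B) h0 k ω])
      _ ≤ 1 := by simpa using prob_le_one
  -- The choice `c = log d` turns `e^c` into `d`, which is at most `D`.
  have key := mul_sum_le_of_entropy hm h0 hB hint hone hlog hI hentropy (Real.log_nonneg hd) n
  rw [← hD, Real.exp_log (by linarith)] at key
  have hfin : ENNReal.ofReal (Real.log d) * D ≤ (1 + ENNReal.ofReal I * J) * D := by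
    refine key.trans ?_
    rw [add_mul, one_mul, mul_assoc]
    exact add_le_add hdD (mul_le_mul_right (sum_setLIntegral_max_le hm h0 hB hanti n hJ) _)
  exact (ENNReal.mul_le_mul_iff_left hDpos hDtop).1 hfin

end Bounds

end SequenceSpace

/-! ### Mean first-passage times of a random walk with positive drift -/

namespace SequenceSpace

variable {X : Type*} [MeasurableSpace X]

/-- At most `⌈|r|⌉` terms are nonzero, each at most `|r|`. The quadratic bound turns a second moment
of `ℓ` into summability of the mean excesses `E(ℓ - k)⁺`. -/
lemma tsum_ofReal_sub_natCast_le (r : ℝ) :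
    ∑' k : ℕ, ENNReal.ofReal (r - k) ≤ ENNReal.ofReal ((|r| + 1) * |r|) := by
  rw [tsum_eq_sum (s := Finset.range ⌈|r|⌉₊) fun k hk => ENNReal.ofReal_of_nonpos (by
    have h1 : (⌈|r|⌉₊ : ℝ) ≤ k := by simpa using hk
    linarith [Nat.le_ceil |r|, le_abs_self r])]
  calc _ ≤ ∑ _k ∈ Finset.range ⌈|r|⌉₊, ENNReal.ofReal |r| :=
        Finset.sum_le_sum fun k _ => ENNReal.ofReal_le_ofReal (by
          have : (0 : ℝ) ≤ k := k.cast_nonneg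
          linarith [le_abs_self r])
    _ = ENNReal.ofReal (⌈|r|⌉₊ : ℝ) * ENNReal.ofReal |r| := by simp
    _ ≤ _ := by
      rw [ENNReal.ofReal_mul (by positivity)]
      gcongr
      exact (Nat.ceil_lt_add_one (abs_nonneg r)).le

/-- A bounded function, superharmonic for a walk that moves down, controlling the visits to
`[k, k + 1)`. -/
noncomputable def visitPotential (k : ℕ) (y : ℝ) : ℝ≥0∞ :=
  ENNReal.ofReal (min 1 (Real.exp ((y - (k + 1)) / 2)))

@[fun_prop]
lemma measurable_visitPotential (k : ℕ) : Measurable (visitPotential k) := by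
  unfold visitPotential; fun_prop

lemma visitPotential_le_one (k : ℕ) (y : ℝ) : visitPotential k y ≤ 1 := by
  rw [← ENNReal.ofReal_one]
  exact ENNReal.ofReal_le_ofReal (min_le_left _ _)

variable {η : Measure X} [IsProbabilityMeasure η] {ℓ : X → ℝ}

lemma lintegral_visitPotential_le_mul (hℓ : Measurable ℓ) {ρ : ℝ}
    (hρ : ∫⁻ x, ENNReal.ofReal (Real.exp (-ℓ x / 2)) ∂η ≤ ENNReal.ofReal ρ) (k : ℕ) (y : ℝ) :
    ∫⁻ x, visitPotential k (y - ℓ x) ∂η ≤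
      ENNReal.ofReal (Real.exp ((y - (k + 1)) / 2) * ρ) := by
  calc _ ≤ ∫⁻ x, ENNReal.ofReal (Real.exp ((y - (k + 1)) / 2)) *
        ENNReal.ofReal (Real.exp (-ℓ x / 2)) ∂η := lintegral_mono fun x => by
        rw [← ENNReal.ofReal_mul (Real.exp_nonneg _), ← Real.exp_add]
        refine ENNReal.ofReal_le_ofReal ((min_le_right _ _).trans_eq ?_)
        ring_nf
    _ = ENNReal.ofReal (Real.exp ((y - (k + 1)) / 2)) *
        ∫⁻ x, ENNReal.ofReal (Real.exp (-ℓ x / 2)) ∂η := lintegral_const_mul _ (by fun_prop)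
    _ ≤ _ := by rw [ENNReal.ofReal_mul (Real.exp_nonneg _)]; gcongr

/-- Below `k + 1` the exponential contracts by `ρ` in one step; above, the potential is already at
its maximum `1`. -/
lemma lintegral_visitPotential_le (hℓ : Measurable ℓ) {ρ : ℝ} (hρ1 : ρ ≤ 1)
    (hρ : ∫⁻ x, ENNReal.ofReal (Real.exp (-ℓ x / 2)) ∂η ≤ ENNReal.ofReal ρ) (k : ℕ) (y : ℝ) :
    ∫⁻ x, visitPotential k (y - ℓ x) ∂η ≤ visitPotential k y := by
  rcases le_total y (k + 1) with hy | hy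
  · refine (lintegral_visitPotential_le_mul hℓ hρ k y).trans (ENNReal.ofReal_le_ofReal ?_)
    rw [min_eq_right (by rw [Real.exp_le_one_iff]; linarith)]
    exact mul_le_of_le_one_right (Real.exp_nonneg _) hρ1
  · have : visitPotential k y = 1 := by
      rw [visitPotential, min_eq_left (by rw [Real.one_le_exp_iff]; linarith), ENNReal.ofReal_one]
    rw [this]
    calc _ ≤ ∫⁻ _x, 1 ∂η := lintegral_mono fun x => visitPotential_le_one _ _
      _ = 1 := by simp

/-- For `y` in `[k, k + 1)` the exponential is at least `e^{-1/2}`, so the contraction by `ρ` is a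
definite loss. Each visit to this interval is thus paid for. -/
lemma lintegral_visitPotential_floor_add_le (hℓ : Measurable ℓ) {ρ : ℝ} (hρ0 : 0 ≤ ρ) (hρ1 : ρ ≤ 1)
    (hρ : ∫⁻ x, ENNReal.ofReal (Real.exp (-ℓ x / 2)) ∂η ≤ ENNReal.ofReal ρ) {y : ℝ} (hy : 0 ≤ y) :
    ∫⁻ x, visitPotential ⌊y⌋₊ (y - ℓ x) ∂η + ENNReal.ofReal ((1 - ρ) * Real.exp (-(1 / 2))) ≤
      visitPotential ⌊y⌋₊ y := by
  have h1 := Nat.floor_le hy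
  have h2 := Nat.lt_floor_add_one y
  refine (add_le_add_left (lintegral_visitPotential_le_mul hℓ hρ _ y) _).trans ?_
  have h3 : Real.exp (-(1 / 2)) ≤ Real.exp ((y - (⌊y⌋₊ + 1)) / 2) :=
    Real.exp_le_exp.2 (by linarith)
  rw [← ENNReal.ofReal_add (mul_nonneg (Real.exp_nonneg _) hρ0)
    (mul_nonneg (by linarith) (Real.exp_nonneg _)), visitPotential,
    min_eq_right (by rw [Real.exp_le_one_iff]; linarith)]
  refine ENNReal.ofReal_le_ofReal ?_
  nlinarith

/-- Integrate `a⁺ = a + (-a)⁺` with `a = (y - ℓ) / I`. The fluid limit `y / I` fails to be a passage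
potential only by the mean overshoot. -/
lemma lintegral_ofReal_sub_div_add_one_le (hint : Integrable ℓ η) {I : ℝ} (hI : 0 < I)
    (hmean : ∫ x, ℓ x ∂η = I) {y : ℝ} (hy : 0 ≤ y) :
    ∫⁻ x, ENNReal.ofReal ((y - ℓ x) / I) ∂η + 1 ≤
      ENNReal.ofReal (y / I) + ∫⁻ x, ENNReal.ofReal ((ℓ x - y) / I) ∂η := by
  have i1 : Integrable (fun x => (y - ℓ x) / I) η := ((integrable_const y).sub hint).div_const I
  have i2 : Integrable (fun x => max ((ℓ x - y) / I) 0) η :=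
    ((hint.sub (integrable_const y)).div_const I).pos_part
  have i3 : Integrable (fun x => max ((y - ℓ x) / I) 0) η := i1.pos_part
  have e : ∀ x, max ((y - ℓ x) / I) 0 = (y - ℓ x) / I + max ((ℓ x - y) / I) 0 := fun x => by
    have h : (ℓ x - y) / I = -((y - ℓ x) / I) := by ring
    rw [h]
    rcases le_total ((y - ℓ x) / I) 0 with h0 | h0
    · rw [max_eq_right h0, max_eq_left (by linarith)]; ring
    · rw [max_eq_left h0, max_eq_right (by linarith)]; ring
  have hmax : ∀ a : ℝ, ENNReal.ofReal a = ENNReal.ofReal (max a 0) := fun a => by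
    rw [ENNReal.ofReal_max]; simp
  simp only [hmax ((y - ℓ _) / I), hmax ((ℓ _ - y) / I)]
  rw [← ofReal_integral_eq_lintegral_ofReal i3 (ae_of_all _ fun x => le_max_right _ _),
    ← ofReal_integral_eq_lintegral_ofReal i2 (ae_of_all _ fun x => le_max_right _ _)]
  have hval : ∫ x, max ((y - ℓ x) / I) 0 ∂η + 1 = y / I + ∫ x, max ((ℓ x - y) / I) 0 ∂η := by
    simp only [e]
    rw [integral_add i1 i2, integral_div, integral_sub (integrable_const y) hint, hmean]
    simp only [integral_const, probReal_univ, smul_eq_mul, one_mul]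
    field_simp
    ring
  have n1 : 0 ≤ ∫ x, max ((y - ℓ x) / I) 0 ∂η := integral_nonneg fun x => le_max_right _ _
  have n2 : 0 ≤ ∫ x, max ((ℓ x - y) / I) 0 ∂η := integral_nonneg fun x => le_max_right _ _
  rw [← ENNReal.ofReal_one, ← ENNReal.ofReal_add n1 zero_le_one, hval,
    ENNReal.ofReal_add (by positivity) n2]

/-- A potential for the first passage of a walk with positive drift, finite variance and an
exponential moment: it decreases by at least `1` in mean at every step from the half-line, and
exceeds the fluid limit `y / I` by at most a constant. -/
lemma exists_passagePotential (hℓ : Measurable ℓ) (hsq : MemLp ℓ 2 η) {I : ℝ} (hI : 0 < I)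
    (hmean : ∫ x, ℓ x ∂η = I) {ρ : ℝ} (hρ0 : 0 ≤ ρ) (hρ1 : ρ < 1)
    (hρ : ∫⁻ x, ENNReal.ofReal (Real.exp (-ℓ x / 2)) ∂η ≤ ENNReal.ofReal ρ) :
    ∃ u : ℝ → ℝ≥0∞, Measurable u ∧ (∀ y, 0 ≤ y → ∫⁻ x, u (y - ℓ x) ∂η + 1 ≤ u y) ∧
      ∃ C : ℝ, 0 ≤ C ∧ ∀ y, 0 ≤ y → u y ≤ ENNReal.ofReal (y / I + C) := by
  have hint : Integrable ℓ η := hsq.integrable one_le_two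
  set κ := (1 - ρ) * Real.exp (-(1 / 2)) with hκ
  have hκ0 : 0 < κ := mul_pos (by linarith) (Real.exp_pos _)
  set a : ℕ → ℝ≥0∞ := fun k => ∫⁻ x, ENNReal.ofReal (ℓ x - k) ∂η with ha
  have hsum : ∑' k, a k ≠ ∞ := by
    rw [ha, ← lintegral_tsum fun k => by fun_prop]
    have hi : Integrable (fun x => (|ℓ x| + 1) * |ℓ x|) η := by
      have : (fun x => (|ℓ x| + 1) * |ℓ x|) = fun x => ℓ x ^ 2 + |ℓ x| := by
        funext x; rw [← sq_abs (ℓ x)]; ring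
      rw [this]
      exact hsq.integrable_sq.add hint.abs
    refine ne_top_of_le_ne_top ?_ (lintegral_mono fun x => tsum_ofReal_sub_natCast_le (ℓ x))
    exact hi.lintegral_lt_top.ne
  -- Starting in `[k, k + 1)`, the mean overshoot term is at most `a k / I`, while `visitPotential
  -- k` drops by at least `κ`; hence `c κ = 1 / I` makes the correction `c ∑ a k * visitPotential k`
  -- absorb it.
  set c : ℝ≥0∞ := ENNReal.ofReal (1 / (I * κ)) with hc
  have hcκ : c * ENNReal.ofReal κ = ENNReal.ofReal (1 / I) := by
    rw [hc, ← ENNReal.ofReal_mul (by positivity)]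
    congr 1; field_simp
  refine ⟨fun y => ENNReal.ofReal (y / I) + c * ∑' k, a k * visitPotential k y,
    by fun_prop, fun y hy => ?_, (c * ∑' k, a k).toReal, ENNReal.toReal_nonneg, fun y hy => ?_⟩
  · have hmeas : ∀ k, Measurable fun x => a k * visitPotential k (y - ℓ x) := fun k => by fun_prop
    have hmeas' : Measurable fun x => ∑' k, a k * visitPotential k (y - ℓ x) := by fun_prop
    have hvis : ∑' k, a k * ∫⁻ x, visitPotential k (y - ℓ x) ∂η + a ⌊y⌋₊ * ENNReal.ofReal κ ≤
        ∑' k, a k * visitPotential k y := by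
      classical
      rw [← tsum_ite_eq ⌊y⌋₊ fun k => a k * ENNReal.ofReal κ, ← ENNReal.tsum_add]
      refine ENNReal.tsum_le_tsum fun k => ?_
      split_ifs with hk
      · subst hk
        rw [← mul_add]
        gcongr
        exact lintegral_visitPotential_floor_add_le hℓ hρ0 hρ1.le hρ hy
      · rw [add_zero]
        gcongr
        exact lintegral_visitPotential_le hℓ hρ1.le hρ k y
    have hdrift : ∫⁻ x, ENNReal.ofReal ((ℓ x - y) / I) ∂η ≤
        ENNReal.ofReal (1 / I) * a ⌊y⌋₊ := by
      rw [ha, ← lintegral_const_mul _ (by fun_prop)]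
      refine lintegral_mono fun x => ?_
      rw [← ENNReal.ofReal_mul (by positivity), div_eq_inv_mul, one_div]
      refine ENNReal.ofReal_le_ofReal (mul_le_mul_of_nonneg_left ?_ (by positivity))
      linarith [Nat.floor_le hy]
    rw [lintegral_add_right _ (hmeas'.const_mul c), lintegral_const_mul _ hmeas',
      lintegral_tsum fun k => (hmeas k).aemeasurable]
    have hconst : ∀ k, ∫⁻ x, a k * visitPotential k (y - ℓ x) ∂η =
        a k * ∫⁻ x, visitPotential k (y - ℓ x) ∂η := fun k =>
      lintegral_const_mul _ (by fun_prop)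
    simp only [hconst]
    calc _ = (∫⁻ x, ENNReal.ofReal ((y - ℓ x) / I) ∂η + 1) +
          c * ∑' k, a k * ∫⁻ x, visitPotential k (y - ℓ x) ∂η := by ring
      _ ≤ (ENNReal.ofReal (y / I) + ENNReal.ofReal (1 / I) * a ⌊y⌋₊) +
          c * ∑' k, a k * ∫⁻ x, visitPotential k (y - ℓ x) ∂η := by
        refine add_le_add ?_ le_rfl
        exact (lintegral_ofReal_sub_div_add_one_le hint hI hmean hy).trans
          (add_le_add le_rfl hdrift)
      _ = ENNReal.ofReal (y / I) + c * (∑' k, a k * ∫⁻ x, visitPotential k (y - ℓ x) ∂η +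
          a ⌊y⌋₊ * ENNReal.ofReal κ) := by rw [← hcκ]; ring
      _ ≤ _ := by gcongr
  · rw [ENNReal.ofReal_add (by positivity) ENNReal.toReal_nonneg,
      ENNReal.ofReal_toReal (ENNReal.mul_ne_top ENNReal.ofReal_ne_top hsum)]
    exact add_le_add le_rfl (mul_le_mul' le_rfl (ENNReal.tsum_le_tsum fun k =>
      mul_le_of_le_one_right zero_le (visitPotential_le_one _ _)))

/-- Supermartingale argument: on `B (ν + n)` the remaining distance to `y` is nonnegative, so one
more step costs at least `1` of the potential. Restriction to an arbitrary `S` in the past of `ν` is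
what makes the bound conditional. -/
lemma sum_measure_passage_le {μ : Measure X} [IsProbabilityMeasure μ] (hℓ : Measurable ℓ)
    {u : ℝ → ℝ≥0∞} (hu : Measurable u) (hstep : ∀ y, 0 ≤ y → ∫⁻ x, u (y - ℓ x) ∂η + 1 ≤ u y)
    {B : ℕ → Set (ℕ → X)} (hB : ∀ t, MeasurableSet[past X t] (B t)) (hanti : Antitone B)
    {ν : ℕ} {S : Set (ℕ → X)} (hS : MeasurableSet[past X ν] S) {y : ℝ}
    (hle : ∀ n, ∀ᵐ ω ∂changeLaw μ η ν, ω ∈ B (ν + n) → ∑ v ∈ Finset.Ico ν (ν + n), ℓ (ω v) ≤ y)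
    (m : ℕ) :
    ∑ n ∈ Finset.range m, changeLaw μ η ν (S ∩ B (ν + n)) ≤ u y * changeLaw μ η ν S := by
  have hSB : ∀ n, MeasurableSet[past X (ν + n)] (S ∩ B (ν + n)) := fun n =>
    MeasurableSet.inter (past_mono (Nat.le_add_right ν n) _ hS) (hB _)
  have hSB' := fun n => past_le _ _ (hSB n)
  have hZ : ∀ n, Measurable[past X (ν + n)]
      fun ω : ℕ → X => ∑ v ∈ Finset.Ico ν (ν + n), ℓ (ω v) := fun n =>
    Finset.measurable_sum _ fun v hv => hℓ.comp (measurable_eval_past (Finset.mem_Ico.1 hv).2)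
  have hZ' := fun n => (hZ n).mono (past_le (ν + n)) le_rfl
  have huZ : ∀ n, Measurable fun ω : ℕ → X => u (y - ∑ v ∈ Finset.Ico ν (ν + n), ℓ (ω v)) :=
    fun n => hu.comp (measurable_const.sub (hZ' n))
  have key : ∀ m, ∑ n ∈ Finset.range m, changeLaw μ η ν (S ∩ B (ν + n)) +
      ∫⁻ ω in S ∩ B (ν + m), u (y - ∑ v ∈ Finset.Ico ν (ν + m), ℓ (ω v)) ∂changeLaw μ η ν ≤
      u y * changeLaw μ η ν S := by
    intro m
    induction m with
    | zero =>
      simp only [Finset.range_zero, Finset.sum_empty, zero_add, add_zero, Finset.Ico_self, sub_zero,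
        lintegral_const, Measure.restrict_apply_univ]
      gcongr
      exact Set.inter_subset_left
    | succ m ih =>
      refine le_trans ?_ ih
      rw [Finset.sum_range_succ, add_assoc]
      gcongr
      calc _ ≤ changeLaw μ η ν (S ∩ B (ν + m)) + ∫⁻ ω in S ∩ B (ν + m),
            u (y - ∑ v ∈ Finset.Ico ν (ν + (m + 1)), ℓ (ω v)) ∂changeLaw μ η ν := by
            gcongr
            exact hanti (by omega)
        _ = ∫⁻ ω in S ∩ B (ν + m), 1 + ∫⁻ x,
            u (y - ∑ v ∈ Finset.Ico ν (ν + m), ℓ (ω v) - ℓ x) ∂η ∂changeLaw μ η ν := by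
          rw [lintegral_add_left measurable_const, setLIntegral_one]
          congr 1
          have hlaw : (if ν + m < ν then μ else η) = η := if_neg (by omega)
          rw [changeLaw, setLIntegral_update _ (ν + m) (hSB m) (huZ (m + 1))]
          simp only [hlaw]
          refine lintegral_congr fun ω => lintegral_congr fun x => ?_
          have := apply_update (hZ m) ω x
          rw [← add_assoc, Finset.sum_Ico_succ_top (Nat.le_add_right ν m), this,
            Function.update_self, sub_add_eq_sub_sub]
        _ ≤ _ := by
          refine setLIntegral_mono_ae (huZ m).aemeasurable.restrict ?_
          filter_upwards [hle m] with ω hω hmem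
          rw [add_comm]
          exact hstep _ (sub_nonneg.2 (hω hmem.2))
  exact le_self_add.trans (key m)

end SequenceSpace

/-! ### Mean time to false alarm -/

namespace SequenceSpace

variable {X : Type*} [MeasurableSpace X]

/-- The Shiryaev-Roberts statistic `∑_{s < t} ∏_{s ≤ u < t} L (ω u)`. -/
noncomputable def shiryaevRoberts (L : X → ℝ≥0∞) (t : ℕ) (ω : ℕ → X) : ℝ≥0∞ :=
  ∑ s ∈ Finset.range t, ∏ u ∈ Finset.Ico s t, L (ω u)

lemma shiryaevRoberts_succ (L : X → ℝ≥0∞) (t : ℕ) (ω : ℕ → X) :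
    shiryaevRoberts L (t + 1) ω = (shiryaevRoberts L t ω + 1) * L (ω t) := by
  rw [shiryaevRoberts, Finset.sum_range_succ, Nat.Ico_succ_singleton, Finset.prod_singleton,
    add_mul, one_mul, shiryaevRoberts, Finset.sum_mul]
  congr 1
  exact Finset.sum_congr rfl fun s hs =>
    Finset.prod_Ico_succ_top (Finset.mem_range.1 hs).le _

lemma measurable_shiryaevRoberts {L : X → ℝ≥0∞} (hL : Measurable L) (t : ℕ) :
    Measurable[past X t] (shiryaevRoberts L t) :=
  Finset.measurable_sum _ fun _ _ => Finset.measurable_prod _ fun _ hu =>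
    hL.comp (measurable_eval_past (Finset.mem_Ico.1 hu).2)

/-- Each `R_i` satisfies `E[R_i(n + 1) | F_n] ≤ R_i(n) + 1`, and the weights sum to `1`, so the
mixture gains at most `1` in mean per unit of time before stopping. Paths leaving at `n + 1` take
away at least `c`. -/
lemma mul_measure_compl_le_sum {ι : Type*} {μ : Measure X} [IsProbabilityMeasure μ] (P : Finset ι)
    {q : ι → ℝ≥0∞} (hq : ∑ i ∈ P, q i = 1) {L : ι → X → ℝ≥0∞} (hL : ∀ i, Measurable (L i))
    (hL1 : ∀ i ∈ P, ∫⁻ x, L i x ∂μ ≤ 1) {B : ℕ → Set (ℕ → X)}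
    (hB : ∀ t, MeasurableSet[past X t] (B t)) (hanti : Antitone B) (hB0 : B 0 = Set.univ)
    {c : ℝ≥0∞}
    (hcross : ∀ n ω, ω ∈ B n → ω ∉ B (n + 1) → c ≤ ∑ i ∈ P, q i * shiryaevRoberts (L i) (n + 1) ω)
    (n : ℕ) :
    c * Measure.infinitePi (fun _ => μ) (B n)ᶜ ≤
      ∑ t ∈ Finset.range n, Measure.infinitePi (fun _ => μ) (B t) := by
  set Q : Measure (ℕ → X) := Measure.infinitePi (fun _ => μ) with hQ
  have hB' : ∀ t, MeasurableSet (B t) := fun t => past_le t _ (hB t)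
  have hR : ∀ n, Measurable[past X n] fun ω => ∑ i ∈ P, q i * shiryaevRoberts (L i) n ω := fun n =>
    Finset.measurable_sum _ fun i _ => (measurable_shiryaevRoberts (hL i) n).const_mul _
  have hR' := fun n => (hR n).mono (past_le n) le_rfl
  have hstep : ∀ n, ∫⁻ ω in B n, ∑ i ∈ P, q i * shiryaevRoberts (L i) (n + 1) ω ∂Q ≤
      ∫⁻ ω in B n, ∑ i ∈ P, q i * shiryaevRoberts (L i) n ω ∂Q + Q (B n) := by
    intro n
    rw [hQ, setLIntegral_update (fun _ => μ) n (hB n) (hR' (n + 1)), ← hQ, ← setLIntegral_one,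
      ← lintegral_add_right _ measurable_const]
    refine lintegral_mono fun ω => ?_
    have hmeas : ∀ i ∈ P, Measurable fun x => q i * ((shiryaevRoberts (L i) n ω + 1) * L i x) :=
      fun i _ => ((hL i).const_mul _).const_mul _
    simp only [shiryaevRoberts_succ, apply_update (measurable_shiryaevRoberts (hL _) n),
      Function.update_self]
    rw [lintegral_finsetSum _ hmeas]
    calc _ ≤ ∑ i ∈ P, (q i * shiryaevRoberts (L i) n ω + q i) := by
          refine Finset.sum_le_sum fun i hi => ?_
          rw [lintegral_const_mul _ ((hL i).const_mul _), lintegral_const_mul _ (hL i)]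
          calc _ ≤ q i * ((shiryaevRoberts (L i) n ω + 1) * 1) := by
                gcongr
                exact hL1 i hi
            _ = _ := by ring
      _ = _ := by rw [Finset.sum_add_distrib, hq]
  have key : ∀ n, c * Q (B n)ᶜ + ∫⁻ ω in B n, ∑ i ∈ P, q i * shiryaevRoberts (L i) n ω ∂Q ≤
      ∑ t ∈ Finset.range n, Q (B t) := by
    intro n
    induction n with
    | zero => simp [hB0, shiryaevRoberts]
    | succ n ih =>
      rw [Finset.sum_range_succ]
      refine le_trans ?_ (add_le_add_left ih _)
      rw [add_assoc]
      refine le_trans ?_ (add_le_add_right (hstep n) _)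
      have hset : (B (n + 1))ᶜ = (B n)ᶜ ∪ B n \ B (n + 1) := by
        ext ω
        have := @hanti n (n + 1) n.le_succ ω
        simp only [Set.mem_compl_iff, Set.mem_union, Set.mem_sdiff]
        tauto
      have hsplit := lintegral_inter_add_sdiff (μ := Q)
        (fun ω => ∑ i ∈ P, q i * shiryaevRoberts (L i) (n + 1) ω) (B n) (hB' (n + 1))
      rw [Set.inter_eq_right.2 (hanti n.le_succ)] at hsplit
      rw [← hsplit, hset]
      have hdiff : c * Q (B n \ B (n + 1)) ≤ ∫⁻ ω in B n \ B (n + 1),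
          ∑ i ∈ P, q i * shiryaevRoberts (L i) (n + 1) ω ∂Q := by
        rw [← setLIntegral_const]
        exact setLIntegral_mono (hR' (n + 1)) fun ω hω => hcross n ω hω.1 hω.2
      calc _ ≤ c * (Q (B n)ᶜ + Q (B n \ B (n + 1))) + _ := by
            gcongr
            exact measure_union_le _ _
        _ = c * Q (B n)ᶜ + (∫⁻ ω in B (n + 1), ∑ i ∈ P, q i * shiryaevRoberts (L i) (n + 1) ω ∂Q +
            c * Q (B n \ B (n + 1))) := by ring
        _ ≤ _ := by gcongr
  exact le_self_add.trans (key n)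

end SequenceSpace

/-! ### Conditional expectations -/

section CondLExp

variable {Ω : Type*} {m m₀ : MeasurableSpace Ω} {Q : Measure[m₀] Ω} [IsProbabilityMeasure Q]

/-- On `m` the measure with density `Y` is dominated by the essential supremum times `Q`;
integrating the `m`-measurable `w` against both gives the claim. -/
lemma lintegral_mul_le_essSup_condLExp (hm : m ≤ m₀) {w Y : Ω → ℝ≥0∞} (hw : Measurable[m] w)
    (hY : Measurable[m₀] Y) :
    ∫⁻ ω, w ω * Y ω ∂Q ≤ essSup (condLExp m Q Y) Q * ∫⁻ ω, w ω ∂Q := by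
  have hle : (Q.withDensity Y).trim hm ≤ essSup (condLExp m Q Y) Q • Q.trim hm := by
    refine Measure.le_iff.2 fun s hs => ?_
    rw [trim_measurableSet_eq hm hs, withDensity_apply _ (hm s hs), Measure.smul_apply, smul_eq_mul,
      trim_measurableSet_eq hm hs, ← setLIntegral_condLExp hm Q Y hs, ← setLIntegral_const]
    exact lintegral_mono_ae (ae_restrict_of_ae (ENNReal.ae_le_essSup _))
  calc ∫⁻ ω, w ω * Y ω ∂Q = ∫⁻ ω, w ω ∂Q.withDensity Y := by
        rw [lintegral_withDensity_eq_lintegral_mul _ hY (hw.mono hm le_rfl)]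
        simp only [Pi.mul_apply, mul_comm]
    _ = ∫⁻ ω, w ω ∂(Q.withDensity Y).trim hm := (lintegral_trim hm hw).symm
    _ ≤ ∫⁻ ω, w ω ∂(essSup (condLExp m Q Y) Q • Q.trim hm) := lintegral_mono' hle le_rfl
    _ = _ := by rw [lintegral_smul_measure, lintegral_trim hm hw, smul_eq_mul]

lemma essSup_condLExp_le (hm : m ≤ m₀) {Y : Ω → ℝ≥0∞} {c : ℝ≥0∞}
    (h : ∀ s, MeasurableSet[m] s → ∫⁻ ω in s, Y ω ∂Q ≤ c * Q s) :
    essSup (condLExp m Q Y) Q ≤ c := by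
  refine essSup_le_of_ae_le c (ae_le_of_ae_le_trim (hm := hm) ?_)
  refine ae_le_of_forall_setLIntegral_le_of_sigmaFinite (measurable_condLExp _ _ _) fun s hs _ => ?_
  rw [setLIntegral_condLExp_trim hm _ _ hs, setLIntegral_const, trim_measurableSet_eq hm hs]
  exact h s hs

end CondLExp

/-! ### Likelihood ratios -/

section LikelihoodRatio

variable {X : Type*} [MeasurableSpace X] {μ : Measure X} [IsProbabilityMeasure μ] {r : X → ℝ≥0}

lemma integrable_of_lintegral_eq_one (hr : Measurable r) (h1 : ∫⁻ x, r x ∂μ = 1) :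
    Integrable (fun x => (r x : ℝ)) μ := by
  refine ⟨by fun_prop, ?_⟩
  rw [hasFiniteIntegral_iff_ofNNReal, h1]
  exact ENNReal.one_lt_top

lemma integral_of_lintegral_eq_one (hr : Measurable r) (h1 : ∫⁻ x, r x ∂μ = 1) :
    ∫ x, (r x : ℝ) ∂μ = 1 := by
  rw [integral_eq_lintegral_of_nonneg_ae (ae_of_all _ fun x => (r x).coe_nonneg) (by fun_prop)]
  simp [h1]

lemma integrable_sqrt_of_lintegral_eq_one (hr : Measurable r) (h1 : ∫⁻ x, r x ∂μ = 1) :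
    Integrable (fun x => √(r x : ℝ)) μ := by
  refine ((integrable_of_lintegral_eq_one hr h1).add (integrable_const 1)).mono' (by fun_prop)
    (ae_of_all _ fun x => ?_)
  rw [Real.norm_of_nonneg (Real.sqrt_nonneg _)]
  have := Real.sq_sqrt (r x).coe_nonneg
  simp only [Pi.add_apply]
  nlinarith [sq_nonneg (√(r x : ℝ) - 1), (r x).coe_nonneg]

/-- The Hellinger affinity of two different probability measures is less than one. -/
lemma integral_sqrt_lt_one (hr : Measurable r) (h1 : ∫⁻ x, r x ∂μ = 1)
    (hne : μ.withDensity (fun x => (r x : ℝ≥0∞)) ≠ μ) : ∫ x, √(r x : ℝ) ∂μ < 1 := by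
  have i1 := integrable_of_lintegral_eq_one hr h1
  have i2 := integrable_sqrt_of_lintegral_eq_one hr h1
  have e : ∀ x, (1 - √(r x : ℝ)) ^ 2 = 1 + (r x : ℝ) - 2 * √(r x : ℝ) := fun x => by
    rw [sub_sq, Real.sq_sqrt (r x).coe_nonneg]; ring
  have i3 : Integrable (fun x => (1 - √(r x : ℝ)) ^ 2) μ := by
    simp only [e]
    exact ((integrable_const 1).add i1).sub (i2.const_mul 2)
  have hval : ∫ x, (1 - √(r x : ℝ)) ^ 2 ∂μ = 2 - 2 * ∫ x, √(r x : ℝ) ∂μ := by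
    simp only [e]
    rw [integral_sub (f := fun x => 1 + (r x : ℝ)) ((integrable_const 1).add i1) (i2.const_mul 2),
      integral_add (integrable_const 1) i1, integral_of_lintegral_eq_one hr h1, integral_const_mul]
    simp
    norm_num
  have hpos : 0 < ∫ x, (1 - √(r x : ℝ)) ^ 2 ∂μ := by
    refine lt_of_le_of_ne (integral_nonneg fun x => sq_nonneg _) fun h0 => hne ?_
    have hae := (integral_eq_zero_iff_of_nonneg (fun x => sq_nonneg _) i3).1 h0.symm
    have hr1 : (fun x => (r x : ℝ≥0∞)) =ᵐ[μ] 1 := by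
      filter_upwards [hae] with x hx
      have hx' : (1 - √(r x : ℝ)) = 0 := by simpa using hx
      have : (r x : ℝ) = 1 := by
        rw [← Real.sq_sqrt (r x).coe_nonneg, show √(r x : ℝ) = 1 by linarith]; norm_num
      have : r x = 1 := by exact_mod_cast this
      simp [this]
    rw [withDensity_congr_ae hr1, withDensity_one]
  linarith

/-- Tilting by `1/2` cancels half of the density: `r · r^{-1/2} = √r`. So the walk has the
exponential moment needed above with no extra assumption. -/
lemma lintegral_exp_neg_half_log_le (hr : Measurable r) (h1 : ∫⁻ x, r x ∂μ = 1) :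
    ∫⁻ x, ENNReal.ofReal (Real.exp (-Real.log (r x) / 2)) ∂μ.withDensity (fun x => (r x : ℝ≥0∞)) ≤
      ENNReal.ofReal (∫ x, √(r x : ℝ) ∂μ) := by
  rw [lintegral_withDensity_eq_lintegral_mul _ (by fun_prop) (by fun_prop),
    ofReal_integral_eq_lintegral_ofReal (integrable_sqrt_of_lintegral_eq_one hr h1)
      (ae_of_all _ fun x => Real.sqrt_nonneg _)]
  refine lintegral_mono fun x => ?_
  rw [Pi.mul_apply, ← ENNReal.ofReal_coe_nnreal, ← ENNReal.ofReal_mul (r x).coe_nonneg]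
  refine ENNReal.ofReal_le_ofReal ?_
  rcases (r x).coe_nonneg.eq_or_lt with h0 | h0
  · have : (r x : ℝ) = 0 := h0.symm
    simp [this]
  · have h0' : (0 : ℝ) < r x := h0
    rw [neg_div, Real.exp_neg, ← Real.log_sqrt h0'.le, Real.exp_log (Real.sqrt_pos.2 h0'),
      ← div_eq_mul_inv, div_le_iff₀ (Real.sqrt_pos.2 h0'), Real.mul_self_sqrt h0'.le]

/-- The Kullback-Leibler divergence of two different probability measures is positive. -/
lemma integral_log_pos (hr : Measurable r) (h1 : ∫⁻ x, r x ∂μ = 1)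
    (hne : μ.withDensity (fun x => (r x : ℝ≥0∞)) ≠ μ)
    [IsProbabilityMeasure (μ.withDensity fun x => (r x : ℝ≥0∞))]
    (hint : Integrable (fun x => Real.log (r x)) (μ.withDensity fun x => (r x : ℝ≥0∞))) :
    0 < ∫ x, Real.log (r x) ∂μ.withDensity (fun x => (r x : ℝ≥0∞)) := by
  have hle := lintegral_exp_neg_half_log_le hr h1
  have hlt := integral_sqrt_lt_one hr h1 hne
  set η := μ.withDensity (fun x => (r x : ℝ≥0∞))
  have hmeas : Measurable fun x => Real.exp (-Real.log (r x) / 2) := by fun_prop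
  have hexp : Integrable (fun x => Real.exp (-Real.log (r x) / 2)) η := by
    refine ⟨hmeas.aestronglyMeasurable, ?_⟩
    rw [hasFiniteIntegral_iff_ofReal (ae_of_all _ fun x => Real.exp_nonneg _)]
    exact hle.trans_lt ENNReal.ofReal_lt_top
  have hlt' : ∫ x, Real.exp (-Real.log (r x) / 2) ∂η < 1 := by
    refine lt_of_le_of_lt ?_ hlt
    rw [← ENNReal.ofReal_le_ofReal_iff (integral_nonneg fun x => Real.sqrt_nonneg _),
      ofReal_integral_eq_lintegral_ofReal hexp (ae_of_all _ fun x => Real.exp_nonneg _)]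
    exact hle
  -- The inequality `1 - e^{-z} ≤ z` with `z = ℓ / 2` bounds the divergence below by twice one minus
  -- the affinity.
  have hmono : ∫ x, (1 - Real.exp (-Real.log (r x) / 2)) ∂η ≤ ∫ x, Real.log (r x) / 2 ∂η := by
    refine integral_mono ((integrable_const 1).sub hexp) (hint.div_const 2) fun x => ?_
    have := Real.add_one_le_exp (-Real.log (r x) / 2)
    simp only
    linarith
  rw [integral_sub (integrable_const 1) hexp, integral_div] at hmono
  simp only [integral_const, probReal_univ, smul_eq_mul, mul_one] at hmono
  linarith

end LikelihoodRatio

/-! ### Detection times -/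

namespace SensorModel

open SequenceSpace

variable {K N : ℕ} {E : Fin K → Type*} [∀ k, MeasurableSpace (E k)]

lemma timeValue_sub_eq_tsum (τ : WithTop ℕ) (ν : ℕ) :
    timeValue τ - (ν : ℝ≥0∞) = ∑' n : ℕ, if ((ν + n : ℕ) : WithTop ℕ) < τ then 1 else 0 := by
  induction τ using WithTop.recTopCoe with
  | top =>
    have h : timeValue ⊤ = ∞ := rfl
    have h' : ∀ n : ℕ, ((ν + n : ℕ) : WithTop ℕ) < ⊤ := fun n => WithTop.coe_lt_top _
    simp only [h, h', if_true, ENNReal.tsum_const]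
    simp
  | coe k =>
    change timeValue (k : WithTop ℕ) - (ν : ℝ≥0∞) =
      ∑' n : ℕ, if ((ν + n : ℕ) : WithTop ℕ) < (k : WithTop ℕ) then 1 else 0
    have h : timeValue (k : WithTop ℕ) = (k : ℝ≥0∞) := rfl
    have h' : ∀ n : ℕ, ((ν + n : ℕ) : WithTop ℕ) < (k : WithTop ℕ) ↔ n < k - ν := fun n => by
      rw [Nat.cast_lt]; omega
    simp only [h, h']
    rw [tsum_eq_sum (s := Finset.range (k - ν)) fun n hn => if_neg (by simpa using hn),
      Finset.sum_congr rfl fun n hn => if_pos (Finset.mem_range.1 hn)]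
    simp [ENNReal.natCast_sub]

variable {T : Path E → WithTop ℕ}

lemma measurableSet_lt_time (hT : IsStoppingTime (filtration E) T) (t : ℕ) :
    MeasurableSet[past (∀ k, E k) t] {ω | (t : WithTop ℕ) < T ω} :=
  hT.measurableSet_gt t

lemma antitone_lt_time (T : Path E → WithTop ℕ) :
    Antitone fun t : ℕ => {ω | (t : WithTop ℕ) < T ω} := fun _ _ hst _ hω =>
  lt_of_le_of_lt (WithTop.coe_le_coe.2 hst) hω

lemma timeValue_sub_eq_tsum_indicator (T : Path E → WithTop ℕ) (ν : ℕ) (ω : Path E) :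
    timeValue (T ω) - (ν : ℝ≥0∞) =
      ∑' n : ℕ, {ω | ((ν + n : ℕ) : WithTop ℕ) < T ω}.indicator 1 ω := by
  rw [timeValue_sub_eq_tsum]
  refine tsum_congr fun n => ?_
  simp [Set.indicator_apply]

lemma measurable_indicator_lt_time (hT : IsStoppingTime (filtration E) T) (t : ℕ) :
    Measurable ({ω | (t : WithTop ℕ) < T ω}.indicator (1 : Path E → ℝ≥0∞)) :=
  measurable_one.indicator (past_le t _ (measurableSet_lt_time hT t))

lemma measurable_timeValue_sub (hT : IsStoppingTime (filtration E) T) (ν : ℕ) :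
    Measurable fun ω => timeValue (T ω) - (ν : ℝ≥0∞) := by
  simp only [timeValue_sub_eq_tsum_indicator]
  exact Measurable.tsum fun n => measurable_indicator_lt_time hT _

lemma setLIntegral_timeValue_sub (hT : IsStoppingTime (filtration E) T) (ν : ℕ)
    (Q : Measure (Path E)) (s : Set (Path E)) :
    ∫⁻ ω in s, timeValue (T ω) - (ν : ℝ≥0∞) ∂Q =
      ∑' n : ℕ, Q (s ∩ {ω | ((ν + n : ℕ) : WithTop ℕ) < T ω}) := by
  simp only [timeValue_sub_eq_tsum_indicator]
  rw [lintegral_tsum fun n => (measurable_indicator_lt_time hT _).aemeasurable]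
  refine tsum_congr fun n => ?_
  have hm := past_le _ _ (measurableSet_lt_time hT (ν + n))
  rw [lintegral_indicator_one hm, Measure.restrict_apply hm, Set.inter_comm]

/-! ### The change-point model -/

variable (M : SensorModel E N)

/-- The likelihood ratio of one observation, as a nonnegative real number. -/
noncomputable def likelihood (A : Finset (Fin N)) (x : ∀ k, E k) : ℝ≥0 :=
  M.density (param A) x / M.density 0 x

lemma measurable_likelihood (A : Finset (Fin N)) : Measurable (M.likelihood A) :=
  (M.measurable_density _).div (M.measurable_density _)

lemma ae_density_ne_zero (θ : Fin N → Fin 2) : ∀ᵐ x ∂M.law θ, M.density θ x ≠ 0 := by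
  rw [law, ae_withDensity_iff (M.measurable_density θ).coe_nnreal_ennreal]
  exact ae_of_all _ fun x hx h => hx (by simp [h])

lemma ae_density_zero_ne_zero {A : Finset (Fin N)} (hA : M.law (param A) ≪ M.law 0) :
    ∀ᵐ x ∂M.law (param A), M.density 0 x ≠ 0 :=
  hA.ae_le (M.ae_density_ne_zero 0)

lemma exp_logLR (A : Finset (Fin N)) (x : ∀ k, E k) :
    EReal.exp (M.logLR A x) = (M.density (param A) x : ℝ≥0∞) / (M.density 0 x : ℝ≥0∞) :=
  ENNReal.exp_log _

/-- Division by zero gives `0` in `ℝ≥0` but may give `∞` in `ℝ≥0∞`, so the two versions of the ratio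
agree only where the density under `0` is nonzero. This holds almost surely under both laws, by
absolute continuity. -/
lemma exp_logLR_of_ne_zero {A : Finset (Fin N)} {x : ∀ k, E k} (hx : M.density 0 x ≠ 0) :
    EReal.exp (M.logLR A x) = M.likelihood A x := by
  rw [exp_logLR, likelihood, ENNReal.coe_div hx]

lemma exp_logLRIncr (A : Finset (Fin N)) (s t : ℕ) (ω : Path E) :
    EReal.exp (M.logLRIncr A s t ω) = ∏ u ∈ Finset.Ico s t, EReal.exp (M.logLR A (ω u)) := by
  rw [logLRIncr]
  induction Finset.Ico s t using Finset.cons_induction with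
  | empty => simp
  | cons a S ha ih => rw [Finset.sum_cons, Finset.prod_cons, EReal.exp_add, ih]

lemma measurable_logLR (A : Finset (Fin N)) : Measurable (M.logLR A) := by
  have h1 := (M.measurable_density (param A)).coe_nnreal_ennreal
  have h2 := (M.measurable_density 0).coe_nnreal_ennreal
  exact ENNReal.measurable_log.comp (h1.div h2)

lemma measurable_logLRIncr (A : Finset (Fin N)) (s t : ℕ) :
    Measurable[past (∀ k, E k) t] (M.logLRIncr A s t) :=
  Finset.measurable_sum _ fun _ hu =>
    (M.measurable_logLR A).comp (measurable_eval_past (Finset.mem_Ico.1 hu).2)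

lemma law_param_eq {A : Finset (Fin N)} (hA : M.law (param A) ≪ M.law 0) :
    M.law (param A) = (M.law 0).withDensity fun x => (M.likelihood A x : ℝ≥0∞) := by
  have hm := fun θ => (M.measurable_density θ).coe_nnreal_ennreal
  have hae := (ae_withDensity_iff (hm (param A))).1 (M.ae_density_zero_ne_zero hA)
  rw [law, law, ← withDensity_mul _ (hm 0) (M.measurable_likelihood A).coe_nnreal_ennreal]
  refine withDensity_congr_ae ?_
  filter_upwards [hae] with x hx
  rw [Pi.mul_apply, ← ENNReal.coe_mul, likelihood]
  by_cases h : M.density (param A) x = 0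
  · simp [h]
  · rw [mul_div_cancel₀ _ (hx (by simpa using h))]

lemma lintegral_likelihood {A : Finset (Fin N)} (hA : M.law (param A) ≪ M.law 0) :
    ∫⁻ x, M.likelihood A x ∂M.law 0 = 1 := by
  have h := measure_univ (μ := M.law (param A))
  rwa [M.law_param_eq hA, withDensity_apply _ MeasurableSet.univ, Measure.restrict_univ] at h

lemma lintegral_exp_logLR_le {A : Finset (Fin N)} (hA : M.law (param A) ≪ M.law 0) :
    ∫⁻ x, EReal.exp (M.logLR A x) ∂M.law 0 ≤ 1 := by
  rw [← M.lintegral_likelihood hA]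
  refine lintegral_mono_ae ?_
  filter_upwards [M.ae_density_ne_zero 0] with x hx using (M.exp_logLR_of_ne_zero hx).le

lemma change_eq_changeLaw (A : Finset (Fin N)) (ν : ℕ) :
    M.change A ν = changeLaw (M.law 0) (M.law (param A)) ν := by
  rw [change, changeLaw]
  congr 1
  funext u
  split_ifs <;> rfl

lemma ae_change_of_ae_law {A : Finset (Fin N)} {ν v : ℕ} (hv : ν ≤ v) {q : (∀ k, E k) → Prop}
    (hq : ∀ᵐ x ∂M.law (param A), q x) : ∀ᵐ ω ∂M.change A ν, q (ω v) := by
  have hmap : (M.change A ν).map (fun ω => ω v) = M.law (param A) := by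
    rw [change, Measure.infinitePi_map_eval, if_neg (not_lt.2 hv)]
  rw [← hmap] at hq
  exact ae_of_ae_map (measurable_pi_apply v).aemeasurable hq

lemma toReal_logLR_of_ne_zero {A : Finset (Fin N)} {x : ∀ k, E k} (h0 : M.density 0 x ≠ 0)
    (hA : M.density (param A) x ≠ 0) :
    (M.logLR A x).toReal = Real.log (M.likelihood A x) := by
  have hpos : (0 : ℝ) < M.likelihood A x := by
    rw [likelihood]; positivity
  rw [logLR, ← ENNReal.coe_div h0, ← likelihood, ← ENNReal.ofReal_coe_nnreal,
    ENNReal.log_ofReal_of_pos hpos, EReal.toReal_coe]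

lemma toReal_logLR_ae {A : Finset (Fin N)} (hA : M.law (param A) ≪ M.law 0) :
    (fun x => (M.logLR A x).toReal) =ᵐ[M.law (param A)] fun x => Real.log (M.likelihood A x) := by
  filter_upwards [M.ae_density_zero_ne_zero hA, M.ae_density_ne_zero (param A)] with x h0 h1
  exact M.toReal_logLR_of_ne_zero h0 h1

lemma map_change_zero (A : Finset (Fin N)) :
    (M.change A 0).map (fun ω => ω 0) = M.law (param A) := by
  rw [change, Measure.infinitePi_map_eval, if_neg (lt_irrefl 0)]

lemma memLp_log_likelihood {A : Finset (Fin N)} (hA : M.law (param A) ≪ M.law 0)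
    (hsq : MemLp (fun ω => (M.logLR A (ω 0)).toReal) 2 (M.change A 0)) :
    MemLp (fun x => Real.log (M.likelihood A x)) 2 (M.law (param A)) := by
  rw [← memLp_congr_ae (M.toReal_logLR_ae hA), ← M.map_change_zero A]
  exact (memLp_map_measure_iff
    (measurable_ereal_toReal.comp (M.measurable_logLR A)).aestronglyMeasurable
    (measurable_pi_apply 0).aemeasurable).2 hsq

lemma info_eq_integral_log {A : Finset (Fin N)} (hA : M.law (param A) ≪ M.law 0) :
    M.info A = ∫ x, Real.log (M.likelihood A x) ∂M.law (param A) := by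
  rw [← integral_congr_ae (M.toReal_logLR_ae hA), info, ← M.map_change_zero A,
    integral_map (measurable_pi_apply 0).aemeasurable
      (measurable_ereal_toReal.comp (M.measurable_logLR A)).aestronglyMeasurable]

lemma info_pos {A : Finset (Fin N)} (hA : M.law (param A) ≪ M.law 0)
    (hne : M.law (param A) ≠ M.law 0)
    (hsq : MemLp (fun ω => (M.logLR A (ω 0)).toReal) 2 (M.change A 0)) : 0 < M.info A := by
  have hint := (M.memLp_log_likelihood hA hsq).integrable one_le_two
  have hprob := M.isProbabilityMeasure_law (param A)
  rw [M.info_eq_integral_log hA]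
  rw [M.law_param_eq hA] at hne hint hprob ⊢
  exact integral_log_pos (M.measurable_likelihood A) (M.lintegral_likelihood hA) hne hint

/-! ### Bounds for the worst-case delay -/

/-- Second-order lower bound for the delay of every rule with mean time to false alarm at least
`γ`. -/
lemma exists_log_sub_le_lordenDelay {A : Finset (Fin N)} (hA : M.law (param A) ≪ M.law 0)
    (hne : M.law (param A) ≠ M.law 0)
    (hsq : MemLp (fun ω => (M.logLR A (ω 0)).toReal) 2 (M.change A 0)) :
    ∃ δ : ℝ, 0 < δ ∧ ∀ γ : ℝ, 1 ≤ δ * γ → ∀ T ∈ M.ruleClass γ,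
      ENNReal.ofReal (Real.log (δ * γ)) ≤ 1 + ENNReal.ofReal (M.info A) * M.lordenDelay A T := by
  set r := M.likelihood A with hr
  have hrm : Measurable r := M.measurable_likelihood A
  have h1 : ∫⁻ x, r x ∂M.law 0 = 1 := M.lintegral_likelihood hA
  have hlaw := M.law_param_eq hA
  have hlaw' : M.law (param A) =
      (M.law 0).withDensity fun x => ENNReal.ofReal (r x : ℝ) := by
    simpa only [ENNReal.ofReal_coe_nnreal] using hlaw
  have hprob := M.isProbabilityMeasure_law (param A)
  have hρ1 : ∫ x, √(r x : ℝ) ∂M.law 0 < 1 := integral_sqrt_lt_one hrm h1 (hlaw ▸ hne)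
  set ρ := ∫ x, √(r x : ℝ) ∂M.law 0 with hρ
  have hρ0 : 0 ≤ ρ := integral_nonneg fun x => Real.sqrt_nonneg _
  have hIpos := M.info_pos hA hne hsq
  have hint := (M.memLp_log_likelihood hA hsq).integrable one_le_two
  have hlog : Integrable (fun x => (r x : ℝ) * Real.log (r x)) (M.law 0) := by
    rw [hlaw, integrable_withDensity_iff_integrable_smul hrm] at hint
    exact hint
  have hentropy : ∫ x, (r x : ℝ) * Real.log (r x) ∂M.law 0 = M.info A := by
    rw [M.info_eq_integral_log hA, hlaw, integral_withDensity_eq_integral_smul hrm]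
    rfl
  -- The factor `1 - ρ` is the Hellinger loss; the `1/2` pays for truncating the mean time to false
  -- alarm at a finite `n`, which also covers `E_∞[T] = ∞`.
  refine ⟨(1 - ρ) / 2, by linarith, fun γ hγ T hT => ?_⟩
  have hγ0 : 0 < γ := by
    by_contra hcon
    nlinarith
  obtain ⟨hτ, hmean⟩ := hT
  obtain ⟨n, hn⟩ : ∃ n : ℕ, ENNReal.ofReal (γ / 2) ≤
      ∑ k ∈ Finset.range n, M.noChange {ω | (k : WithTop ℕ) < T ω} := by
    have htsum := setLIntegral_timeValue_sub hτ 0 M.noChange Set.univ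
    simp only [Measure.restrict_univ, Nat.cast_zero, tsub_zero, zero_add, Set.univ_inter] at htsum
    rw [htsum, ENNReal.tsum_eq_iSup_nat] at hmean
    have hlt : ENNReal.ofReal (γ / 2) < ENNReal.ofReal γ :=
      (ENNReal.ofReal_lt_ofReal_iff hγ0).2 (by linarith)
    obtain ⟨n, hn⟩ := lt_iSup_iff.1 (hlt.trans_le hmean)
    exact ⟨n, hn.le⟩
  rw [hlaw'] at hprob
  refine log_le_one_add_mul_delay (B := fun t => {ω | (t : WithTop ℕ) < T ω}) (μ := M.law 0)
    (h := fun x => (r x : ℝ)) hrm.coe_nnreal_real (fun x => (r x).coe_nonneg)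
    (measurableSet_lt_time hτ) (antitone_lt_time T)
    (integrable_of_lintegral_eq_one hrm h1) (integral_of_lintegral_eq_one hrm h1) hlog hIpos.le
    hentropy hρ0 hρ1.le
    (ofReal_integral_eq_lintegral_ofReal (integrable_sqrt_of_lintegral_eq_one hrm h1)
      (ae_of_all _ fun x => Real.sqrt_nonneg _)).symm n (fun ν w hw => ?_) hγ ?_
  · rw [← hlaw', ← M.change_eq_changeLaw]
    have hw' := hw.mono (past_le ν) le_rfl
    refine le_trans ?_ ((lintegral_mul_le_essSup_condLExp (Q := M.change A ν)
      ((filtration E).le ν) hw (measurable_timeValue_sub hτ ν)).trans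
        (mul_le_mul_left (le_iSup (fun ν : ℕ => essSup (condLExp (filtration E ν) (M.change A ν)
          fun ω => timeValue (T ω) - (ν : ℝ≥0∞)) (M.change A ν)) ν) _))
    have hpt : ∀ ω, ∑ t ∈ Finset.Ico ν n, {ω | (t : WithTop ℕ) < T ω}.indicator w ω ≤
        w ω * (timeValue (T ω) - (ν : ℝ≥0∞)) := by
      intro ω
      rw [timeValue_sub_eq_tsum_indicator, Finset.sum_Ico_eq_sum_range]
      refine le_trans (le_of_eq ?_) (mul_le_mul_right
        (ENNReal.sum_le_tsum (Finset.range (n - ν))) _)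
      rw [Finset.mul_sum]
      refine Finset.sum_congr rfl fun t _ => ?_
      simp [Set.indicator_apply]
    refine le_trans (le_of_eq ?_) (lintegral_mono hpt)
    rw [lintegral_finsetSum _ fun t _ =>
      hw'.indicator (past_le t _ (measurableSet_lt_time hτ t))]
    exact Finset.sum_congr rfl fun t _ =>
      (lintegral_indicator (past_le t _ (measurableSet_lt_time hτ t)) _).symm
  · refine le_trans (le_of_eq ?_) (mul_le_mul_right hn _)
    rw [← ENNReal.ofReal_mul (by linarith)]
    congr 1
    ring

/-- Second-order upper bound for the delay of a rule which stops as soon as the log-likelihood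
ratio of the observations after some time exceeds `y`. -/
lemma exists_lordenDelay_le {A : Finset (Fin N)} (hA : M.law (param A) ≪ M.law 0)
    (hne : M.law (param A) ≠ M.law 0)
    (hsq : MemLp (fun ω => (M.logLR A (ω 0)).toReal) 2 (M.change A 0)) :
    ∃ C : ℝ, 0 ≤ C ∧ ∀ y : ℝ, 0 ≤ y → ∀ T : Path E → WithTop ℕ, IsStoppingTime (filtration E) T →
      (∀ ω, ∀ s t : ℕ, s < t → (t : WithTop ℕ) < T ω →
        EReal.exp (M.logLRIncr A s t ω) ≤ ENNReal.ofReal (Real.exp y)) →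
      M.lordenDelay A T ≤ ENNReal.ofReal (y / M.info A + C) := by
  set r := M.likelihood A with hr
  have hrm : Measurable r := M.measurable_likelihood A
  have h1 : ∫⁻ x, r x ∂M.law 0 = 1 := M.lintegral_likelihood hA
  have hlaw := M.law_param_eq hA
  have hρ1 : ∫ x, √(r x : ℝ) ∂M.law 0 < 1 := integral_sqrt_lt_one hrm h1 (hlaw ▸ hne)
  have hρ0 : 0 ≤ ∫ x, √(r x : ℝ) ∂M.law 0 := integral_nonneg fun x => Real.sqrt_nonneg _
  have hℓ : Measurable fun x => Real.log (r x) := hrm.coe_nnreal_real.log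
  obtain ⟨u, hu, hstep, C, hC, huC⟩ := exists_passagePotential (η := M.law (param A)) hℓ
    (M.memLp_log_likelihood hA hsq) (M.info_pos hA hne hsq) (M.info_eq_integral_log hA).symm
    hρ0 hρ1 (hlaw ▸ lintegral_exp_neg_half_log_le hrm h1)
  refine ⟨C, hC, fun y hy T hT hcont => le_trans ?_ (huC y hy)⟩
  refine iSup_le fun ν => essSup_condLExp_le ((filtration E).le ν) fun s hs => ?_
  rw [setLIntegral_timeValue_sub hT, ENNReal.tsum_eq_iSup_nat]
  refine iSup_le fun m => ?_
  rw [M.change_eq_changeLaw]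
  refine sum_measure_passage_le hℓ hu hstep (B := fun t => {ω | (t : WithTop ℕ) < T ω})
    (measurableSet_lt_time hT) (antitone_lt_time T) hs (fun n => ?_) m
  -- For `n = 0` the hypothesis on `T` says nothing; the empty sum is below `y` because `0 ≤ y`.
  rcases Nat.eq_zero_or_pos n with rfl | hn
  · exact ae_of_all _ fun ω _ => by simpa using hy
  rw [← M.change_eq_changeLaw]
  have hpos : ∀ᵐ ω ∂M.change A ν, ∀ v ∈ Finset.Ico ν (ν + n),
      M.density 0 (ω v) ≠ 0 ∧ M.density (param A) (ω v) ≠ 0 := by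
    rw [Finset.eventually_all]
    intro v hv
    refine M.ae_change_of_ae_law (Finset.mem_Ico.1 hv).1
      (q := fun x => M.density 0 x ≠ 0 ∧ M.density (param A) x ≠ 0) ?_
    exact (M.ae_density_zero_ne_zero hA).and (M.ae_density_ne_zero (param A))
  filter_upwards [hpos] with ω hω hmem
  have hle := hcont ω ν (ν + n) (by omega) hmem
  rw [exp_logLRIncr, Finset.prod_congr rfl fun v hv => M.exp_logLR_of_ne_zero (hω v hv).1] at hle
  have hrpos : ∀ v ∈ Finset.Ico ν (ν + n), (0 : ℝ) < M.likelihood A (ω v) := fun v hv => by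
    have h0 := pos_iff_ne_zero.2 (hω v hv).1
    have h2 := pos_iff_ne_zero.2 (hω v hv).2
    exact NNReal.coe_pos.2 (div_pos h2 h0)
  simp only [← ENNReal.ofReal_coe_nnreal] at hle
  rw [← ENNReal.ofReal_prod_of_nonneg fun v _ => NNReal.coe_nonneg _,
    ENNReal.ofReal_le_ofReal_iff (Real.exp_nonneg _)] at hle
  rw [← Real.log_prod fun v hv => (hrpos v hv).ne']
  exact (Real.log_le_iff_le_exp (Finset.prod_pos hrpos)).2 hle

end SensorModel

/-! ### The three CUSUM rules -/

namespace SensorModel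

open SequenceSpace

variable {K N : ℕ} {E : Fin K → Type*} [∀ k, MeasurableSpace (E k)]

/-- The properties of a detection rule at level `γ` on which its false alarm rate and its delay
depend: it stops only when the weighted Shiryaev-Roberts statistic has reached `γ`, and as soon as
some weighted likelihood ratio reaches `γ`. -/
structure IsCusumRule (M : SensorModel E N) (P : Finset (Finset (Fin N)))
    (p : Finset (Fin N) → ℝ) (γ : ℝ) (T : Path E → WithTop ℕ) : Prop where
  isStoppingTime : IsStoppingTime (filtration E) T
  one_le : ∀ ω, 1 ≤ T ω
  le_shiryaevRoberts : 1 < γ → ∀ ω, ∀ t : ℕ, T ω = t → ENNReal.ofReal γ ≤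
    ∑ A ∈ P, ENNReal.ofReal (p A) * shiryaevRoberts (fun x => EReal.exp (M.logLR A x)) t ω
  lt_of_lt : ∀ ω, ∀ s t : ℕ, ∀ A ∈ P, s < t → (t : WithTop ℕ) < T ω →
    ENNReal.ofReal (p A) * EReal.exp (M.logLRIncr A s t ω) < ENNReal.ofReal γ

variable {M : SensorModel E N} {P : Finset (Finset (Fin N))} {p : Finset (Fin N) → ℝ} {γ : ℝ}
  {T : Path E → WithTop ℕ}

lemma one_le_hittingAfter {β : Type*} (u : ℕ → Path E → β) (s : Set β) (ω : Path E) :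
    1 ≤ hittingAfter u s 1 ω := le_hittingAfter ω

lemma mem_of_hittingAfter_eq {β : Type*} {u : ℕ → Path E → β} {s : Set β} {ω : Path E} {t : ℕ}
    (h : hittingAfter u s 1 ω = t) : 1 ≤ t ∧ u t ω ∈ s := by
  have h1 := one_le_hittingAfter u s ω
  have h2 := hittingAfter_mem_set_of_ne_top (u := u) (s := s) (n := 1) (ω := ω)
    (by rw [h]; exact WithTop.coe_ne_top)
  rw [h] at h1 h2
  exact ⟨by exact_mod_cast h1, h2⟩

lemma exp_logLRIncr_le_shiryaevRoberts (M : SensorModel E N) (A : Finset (Fin N)) {s t : ℕ}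
    (hst : s < t) (ω : Path E) :
    EReal.exp (M.logLRIncr A s t ω) ≤ shiryaevRoberts (fun x => EReal.exp (M.logLR A x)) t ω := by
  rw [exp_logLRIncr]
  exact Finset.single_le_sum
    (f := fun s => ∏ u ∈ Finset.Ico s t, EReal.exp (M.logLR A (ω u)))
    (fun _ _ => zero_le) (Finset.mem_range.2 hst)

lemma isStoppingTime_hittingAfter_Ici {β : Type*} [TopologicalSpace β] [MeasurableSpace β]
    [OpensMeasurableSpace β] [Preorder β] [OrderClosedTopology β] {u : ℕ → Path E → β} {b : β}
    (hu : ∀ t, Measurable[past (∀ k, E k) t] (u t)) :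
    IsStoppingTime (filtration E) (hittingAfter u (Set.Ici b) 1) :=
  Adapted.isStoppingTime_hittingAfter hu measurableSet_Ici

lemma sum_ofReal_eq_one (hp_pos : ∀ A ∈ P, 0 < p A) (hp_sum : ∑ A ∈ P, p A = 1) :
    ∑ A ∈ P, ENNReal.ofReal (p A) = 1 := by
  rw [← ENNReal.ofReal_sum_of_nonneg fun A hA => (hp_pos A hA).le, hp_sum, ENNReal.ofReal_one]

lemma measurable_exp_logLRIncr (M : SensorModel E N) (A : Finset (Fin N)) {s t : ℕ} :
    Measurable[past (∀ k, E k) t] fun ω => EReal.exp (M.logLRIncr A s t ω) :=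
  EReal.measurable_exp.comp (M.measurable_logLRIncr A s t)

lemma isCusumRule_mixCusumTilde (hγ : 1 ≤ γ) : M.IsCusumRule P p γ
    (M.mixCusumTilde P p (Real.log γ)) where
  isStoppingTime := isStoppingTime_hittingAfter_Ici fun t =>
    Finset.measurable_sum _ fun A _ => (EReal.measurable_exp.comp
      (Measurable.biSup _ (Finset.countable_toSet _) fun s _ =>
        M.measurable_logLRIncr A s t)).const_mul _
  one_le := one_le_hittingAfter _ _
  le_shiryaevRoberts h1 ω t ht := by
    obtain ⟨ht1, hmem⟩ := mem_of_hittingAfter_eq ht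
    rw [Set.mem_Ici, Real.exp_log (by linarith)] at hmem
    refine hmem.trans (Finset.sum_le_sum fun A _ => ?_)
    gcongr
    obtain ⟨s, hs, hmax⟩ := Finset.exists_max_image (Finset.range t)
      (fun s => M.logLRIncr A s t ω) ⟨0, Finset.mem_range.2 ht1⟩
    refine le_trans ?_ (M.exp_logLRIncr_le_shiryaevRoberts A (Finset.mem_range.1 hs) ω)
    exact EReal.exp_le_exp_iff.2 (iSup₂_le hmax)
  lt_of_lt ω s t A hA hst ht := by
    have hnot := notMem_of_lt_hittingAfter (k := t) ht (by omega)
    rw [Set.mem_Ici, Real.exp_log (by linarith), not_le] at hnot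
    refine lt_of_le_of_lt ?_ hnot
    refine le_trans ?_ (Finset.single_le_sum
      (f := fun A => ENNReal.ofReal (p A) * EReal.exp (M.cusumYTilde A t ω))
      (fun _ _ => zero_le) hA)
    gcongr
    exact le_iSup₂ (f := fun s _ => M.logLRIncr A s t ω) s (Finset.mem_range.2 hst)

lemma isCusumRule_mixCusumBar (hp_pos : ∀ A ∈ P, 0 < p A) (hp_sum : ∑ A ∈ P, p A = 1)
    (hγ : 1 ≤ γ) : M.IsCusumRule P p γ (M.mixCusumBar P p (Real.log γ)) where
  isStoppingTime := isStoppingTime_hittingAfter_Ici fun t =>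
    Measurable.biSup _ (Finset.countable_toSet _) fun s _ =>
      Finset.measurable_sum _ fun A _ => (M.measurable_exp_logLRIncr A).const_mul _
  one_le := one_le_hittingAfter _ _
  le_shiryaevRoberts h1 ω t ht := by
    obtain ⟨ht1, hmem⟩ := mem_of_hittingAfter_eq ht
    rw [Set.mem_Ici, Real.exp_log (by linarith), ← Finset.sup_eq_iSup,
      Finset.le_sup_iff (ENNReal.ofReal_pos.2 (by linarith))] at hmem
    obtain ⟨s, hs, hle⟩ := hmem
    refine hle.trans ?_
    -- The term `s = t`, absent from the Shiryaev-Roberts sum, equals `1` and cannot reach `γ > 1`.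
    rcases (Nat.lt_succ_iff.1 (Finset.mem_range.1 hs)).eq_or_lt with rfl | hst
    · have hone : ∑ A ∈ P, ENNReal.ofReal (p A) * EReal.exp (M.logLRIncr A s s ω) = 1 := by
        simp only [exp_logLRIncr, Finset.Ico_self, Finset.prod_empty, mul_one]
        exact sum_ofReal_eq_one hp_pos hp_sum
      rw [hone, ENNReal.ofReal_le_one] at hle
      linarith
    · exact Finset.sum_le_sum fun A _ => mul_le_mul' le_rfl
        (M.exp_logLRIncr_le_shiryaevRoberts A hst ω)
  lt_of_lt ω s t A hA hst ht := by
    have hnot := notMem_of_lt_hittingAfter (k := t) ht (by omega)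
    rw [Set.mem_Ici, Real.exp_log (by linarith), not_le] at hnot
    refine lt_of_le_of_lt ?_ hnot
    refine le_trans (Finset.single_le_sum
      (f := fun A => ENNReal.ofReal (p A) * EReal.exp (M.logLRIncr A s t ω))
      (fun _ _ => zero_le) hA) ?_
    exact le_iSup₂ (f := fun s _ =>
      ∑ A ∈ P, ENNReal.ofReal (p A) * EReal.exp (M.logLRIncr A s t ω)) s
      (Finset.mem_range.2 (by omega))

lemma exp_add_log {a : ℝ} (ha : 0 < a) (z : EReal) :
    EReal.exp (z + (Real.log a : ℝ)) = ENNReal.ofReal a * EReal.exp z := by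
  rw [EReal.exp_add, EReal.exp_coe, Real.exp_log ha, mul_comm]

lemma isCusumRule_glrCusum (hp_pos : ∀ A ∈ P, 0 < p A) (hp_sum : ∑ A ∈ P, p A = 1)
    (hγ : 1 ≤ γ) : M.IsCusumRule P p γ (M.glrCusum P p (Real.log γ)) where
  isStoppingTime := isStoppingTime_hittingAfter_Ici fun t =>
    Measurable.biSup _ (Finset.countable_toSet _) fun A _ =>
      (Measurable.biSup _ (Finset.countable_toSet _) fun s _ =>
        M.measurable_logLRIncr A s t).add_const _
  one_le := one_le_hittingAfter _ _
  le_shiryaevRoberts h1 ω t ht := by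
    obtain ⟨ht1, hmem⟩ := mem_of_hittingAfter_eq ht
    rw [Set.mem_Ici, ← Finset.sup_eq_iSup, Finset.le_sup_iff (EReal.bot_lt_coe _)] at hmem
    obtain ⟨A, hA, hle⟩ := hmem
    obtain ⟨s, hs, hmax⟩ := Finset.exists_max_image (Finset.range (t + 1))
      (fun s => M.logLRIncr A s t ω) ⟨0, Finset.mem_range.2 (by omega)⟩
    have hY : M.cusumY A t ω ≤ M.logLRIncr A s t ω := iSup₂_le hmax
    have hle' : ENNReal.ofReal γ ≤ ENNReal.ofReal (p A) * EReal.exp (M.logLRIncr A s t ω) := by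
      rw [← exp_add_log (hp_pos A hA), ← Real.exp_log (show 0 < γ by linarith), ← EReal.exp_coe]
      refine EReal.exp_le_exp_iff.2 ?_
      exact hle.trans (add_le_add_left hY _)
    rcases (Nat.lt_succ_iff.1 (Finset.mem_range.1 hs)).eq_or_lt with rfl | hst
    · rw [exp_logLRIncr, Finset.Ico_self, Finset.prod_empty, mul_one,
        ENNReal.ofReal_le_ofReal_iff (hp_pos A hA).le] at hle'
      have := Finset.single_le_sum (f := p) (fun A hA => (hp_pos A hA).le) hA
      linarith
    · refine hle'.trans ((mul_le_mul' le_rfl (M.exp_logLRIncr_le_shiryaevRoberts A hst ω)).trans ?_)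
      exact Finset.single_le_sum (f := fun A => ENNReal.ofReal (p A) *
        shiryaevRoberts (fun x => EReal.exp (M.logLR A x)) t ω) (fun _ _ => zero_le) hA
  lt_of_lt ω s t A hA hst ht := by
    have hnot := notMem_of_lt_hittingAfter (k := t) ht (by omega)
    rw [Set.mem_Ici, not_le] at hnot
    rw [← exp_add_log (hp_pos A hA), ← Real.exp_log (show 0 < γ by linarith), ← EReal.exp_coe,
      EReal.exp_strictMono.lt_iff_lt]
    refine lt_of_le_of_lt ?_ hnot
    refine le_trans ?_ (le_iSup₂ (f := fun A _ =>
      M.cusumY A t ω + ((Real.log (p A) : ℝ) : EReal)) A hA)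
    exact add_le_add_left (le_iSup₂ (f := fun s _ => M.logLRIncr A s t ω) s
      (Finset.mem_range.2 (by omega))) _

/-- The mean time to false alarm of a CUSUM rule at level `γ` is at least `γ`. -/
lemma IsCusumRule.mem_ruleClass (hT : M.IsCusumRule P p γ T) (hγ : 1 ≤ γ)
    (hp_pos : ∀ A ∈ P, 0 < p A) (hp_sum : ∑ A ∈ P, p A = 1)
    (h_ac : ∀ A ∈ P, M.law (param A) ≪ M.law 0) : T ∈ M.ruleClass γ := by
  refine ⟨hT.isStoppingTime, ?_⟩
  set B : ℕ → Set (Path E) := fun t => {ω | (t : WithTop ℕ) < T ω} with hB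
  have hBm := measurableSet_lt_time hT.isStoppingTime
  have hB0 : B 0 = Set.univ := Set.eq_univ_of_forall fun ω =>
    lt_of_lt_of_le (by exact_mod_cast zero_lt_one) (hT.one_le ω)
  have htsum : ∫⁻ ω, timeValue (T ω) ∂M.noChange = ∑' n : ℕ, M.noChange (B n) := by
    simpa using setLIntegral_timeValue_sub hT.isStoppingTime 0 M.noChange Set.univ
  have hsum : ∀ n, ∑ t ∈ Finset.range n, M.noChange (B t) ≤
      ∫⁻ ω, timeValue (T ω) ∂M.noChange := fun n => htsum ▸ ENNReal.sum_le_tsum _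
  -- At `γ = 1` the term `s = t` may trigger the stop, but there `T ≥ 1` suffices.
  rcases hγ.eq_or_lt with rfl | hγ1
  · simpa [hB0] using hsum 1
  by_cases htop : ∫⁻ ω, timeValue (T ω) ∂M.noChange = ∞
  · rw [htop]; exact le_top
  have hcompl : ∀ n, ENNReal.ofReal γ * M.noChange (B n)ᶜ ≤
      ∑ t ∈ Finset.range n, M.noChange (B t) := by
    refine mul_measure_compl_le_sum (μ := M.law 0) P (sum_ofReal_eq_one hp_pos hp_sum)
      (L := fun A x => EReal.exp (M.logLR A x))
      (fun A => EReal.measurable_exp.comp (M.measurable_logLR A))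
      (fun A hA => M.lintegral_exp_logLR_le (h_ac A hA)) hBm (antitone_lt_time T) hB0
      fun n ω hn hn1 => hT.le_shiryaevRoberts hγ1 ω (n + 1) (le_antisymm (not_lt.1 hn1) ?_)
    have hn' : (n : WithTop ℕ) < T ω := hn
    cases h : T ω with
    | top => exact le_top
    | coe k =>
      rw [h] at hn'
      exact WithTop.coe_le_coe.2 (WithTop.coe_lt_coe.1 hn')
  -- A finite mean makes `T` almost surely finite, so `P_∞(T ≤ n)` increases to `1`.
  have hunion : M.noChange (⋃ n, (B n)ᶜ) = 1 := by
    have hmeas : Measurable fun ω => timeValue (T ω) := by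
      simpa using measurable_timeValue_sub hT.isStoppingTime 0
    rw [← prob_compl_eq_zero_iff (MeasurableSet.iUnion fun n => (past_le n _ (hBm n)).compl)]
    refine measure_mono_null (fun ω hω => ?_) (ae_iff.1 (ae_lt_top hmeas htop))
    simp only [Set.compl_iUnion, compl_compl, Set.mem_iInter] at hω
    have hTtop : T ω = ⊤ := by
      by_contra hne
      obtain ⟨k, hk⟩ := WithTop.ne_top_iff_exists.1 hne
      exact lt_irrefl _ (lt_of_lt_of_eq (hω k) hk.symm)
    simp only [Set.mem_ofPred_eq, hTtop]
    exact lt_irrefl _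
  have hmono : Monotone fun n => (B n)ᶜ := fun _ _ h =>
    Set.compl_subset_compl.2 (antitone_lt_time T h)
  calc ENNReal.ofReal γ = ENNReal.ofReal γ * ⨆ n, M.noChange (B n)ᶜ := by
        rw [← hmono.measure_iUnion, hunion, mul_one]
    _ = ⨆ n, ENNReal.ofReal γ * M.noChange (B n)ᶜ := ENNReal.mul_iSup _ _
    _ ≤ _ := iSup_le fun n => (hcompl n).trans (hsum n)

/-- The delay of CUSUM rules and the optimal delay agree with `log γ / I_A` up to a constant. -/
lemma exists_delay_bounds {T : ℝ → Path E → WithTop ℕ}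
    (hT : ∀ γ, 1 ≤ γ → M.IsCusumRule P p γ (T γ))
    (hp_pos : ∀ A ∈ P, 0 < p A) (hp_sum : ∑ A ∈ P, p A = 1)
    (h_ac : ∀ A ∈ P, M.law (param A) ≪ M.law 0) {A : Finset (Fin N)} (hA : A ∈ P)
    (hne : M.law (param A) ≠ M.law 0)
    (hsq : MemLp (fun ω => (M.logLR A (ω 0)).toReal) 2 (M.change A 0)) :
    ∃ C : ℝ, ∀ᶠ γ : ℝ in atTop, M.lordenDelay A (T γ) ≠ ∞ ∧
      (M.lordenDelay A (T γ)).toReal ≤ Real.log γ / M.info A + C ∧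
      (M.optimalDelay A γ).toReal ≤ (M.lordenDelay A (T γ)).toReal ∧
      Real.log γ / M.info A - C ≤ (M.optimalDelay A γ).toReal := by
  have hI := M.info_pos (h_ac A hA) hne hsq
  obtain ⟨C₁, hC₁, hupper⟩ := M.exists_lordenDelay_le (h_ac A hA) hne hsq
  obtain ⟨δ, hδ, hlower⟩ := M.exists_log_sub_le_lordenDelay (h_ac A hA) hne hsq
  have hpA := hp_pos A hA
  have hpA1 : p A ≤ 1 := hp_sum ▸ Finset.single_le_sum (fun A hA => (hp_pos A hA).le) hA
  have hlogp : Real.log (p A) ≤ 0 := Real.log_nonpos hpA.le hpA1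
  refine ⟨max (-Real.log (p A) / M.info A + C₁) ((1 - Real.log δ) / M.info A), ?_⟩
  filter_upwards [eventually_ge_atTop (1 : ℝ), eventually_ge_atTop (1 / δ)] with γ hγ hγδ
  have hγ0 : 0 < γ := by linarith
  have hlogγ := Real.log_nonneg hγ
  have hδγ : 1 ≤ δ * γ := by
    rw [div_le_iff₀ hδ] at hγδ; linarith
  -- The threshold is `y = log γ - log p_A`: the weight of `A` costs only the constant `-log p_A /
  -- I_A` in the delay.
  have hup : M.lordenDelay A (T γ) ≤
      ENNReal.ofReal ((Real.log γ - Real.log (p A)) / M.info A + C₁) := by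
    refine hupper _ (by linarith) (T γ) (hT γ hγ).isStoppingTime fun ω s t hst ht => ?_
    have h := ((hT γ hγ).lt_of_lt ω s t A hA hst ht).le
    rw [Real.exp_sub, Real.exp_log hγ0, Real.exp_log hpA, ENNReal.ofReal_div_of_pos hpA,
      ENNReal.le_div_iff_mul_le (Or.inl (ENNReal.ofReal_pos.2 hpA).ne')
        (Or.inl ENNReal.ofReal_ne_top), mul_comm]
    exact h
  have hfin : M.lordenDelay A (T γ) ≠ ∞ := ne_top_of_le_ne_top ENNReal.ofReal_ne_top hup
  have hopt : M.optimalDelay A γ ≤ M.lordenDelay A (T γ) :=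
    iInf₂_le (T γ) ((hT γ hγ).mem_ruleClass hγ hp_pos hp_sum h_ac)
  have hopt_ge : ENNReal.ofReal ((Real.log (δ * γ) - 1) / M.info A) ≤ M.optimalDelay A γ := by
    refine le_iInf₂ fun T' hT' => ?_
    have h := hlower γ hδγ T' hT'
    rw [ENNReal.ofReal_div_of_pos hI]
    refine ENNReal.div_le_of_le_mul' ?_
    rw [ENNReal.ofReal_sub _ zero_le_one, ENNReal.ofReal_one]
    exact tsub_le_iff_left.2 h
  refine ⟨hfin, ?_, ENNReal.toReal_mono hfin hopt, ?_⟩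
  · have h0 : 0 ≤ (Real.log γ - Real.log (p A)) / M.info A + C₁ :=
      add_nonneg (div_nonneg (by linarith) hI.le) hC₁
    refine (ENNReal.toReal_le_of_le_ofReal h0 hup).trans ?_
    rw [sub_div, neg_div]
    have := le_max_left (-(Real.log (p A) / M.info A) + C₁) ((1 - Real.log δ) / M.info A)
    linarith
  · have h := (ENNReal.ofReal_le_iff_le_toReal (ne_top_of_le_ne_top hfin hopt)).1 hopt_ge
    refine le_trans ?_ h
    rw [Real.log_mul hδ.ne' hγ0.ne']
    have h2 := le_max_right (-Real.log (p A) / M.info A + C₁) ((1 - Real.log δ) / M.info A)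
    have e : (Real.log δ + Real.log γ - 1) / M.info A =
      Real.log γ / M.info A - (1 - Real.log δ) / M.info A := by ring
    rw [e]
    linarith

lemma secondOrderOptimal_and_hasSecondOrderDelay {T : ℝ → Path E → WithTop ℕ}
    (hT : ∀ γ, 1 ≤ γ → M.IsCusumRule P p γ (T γ))
    (hp_pos : ∀ A ∈ P, 0 < p A) (hp_sum : ∑ A ∈ P, p A = 1)
    (h_ac : ∀ A ∈ P, M.law (param A) ≪ M.law 0)
    (hne : ∀ A ∈ P, M.law (param A) ≠ M.law 0)
    (hsq : ∀ A ∈ P, MemLp (fun ω => (M.logLR A (ω 0)).toReal) 2 (M.change A 0)) :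
    M.SecondOrderOptimal P T ∧ M.HasSecondOrderDelay P T := by
  refine ⟨⟨fun γ hγ => (hT γ hγ).mem_ruleClass hγ hp_pos hp_sum h_ac, fun A hA => ?_⟩,
    fun A hA => ?_⟩
  all_goals
    obtain ⟨C, hC⟩ := exists_delay_bounds hT hp_pos hp_sum h_ac hA (hne A hA) (hsq A hA)
    refine ⟨hC.mono fun γ h => h.1, ?_⟩
  -- The delay and the optimum both lie within `C` of `log γ / I_A`, hence within `2 C` of each
  -- other.
  · refine IsBigO.of_bound (2 * C) (hC.mono fun γ h => ?_)
    rw [norm_one, mul_one, Real.norm_eq_abs, abs_le]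
    constructor <;> linarith [h.2.1, h.2.2.1, h.2.2.2]
  · refine IsBigO.of_bound C (hC.mono fun γ h => ?_)
    rw [norm_one, mul_one, Real.norm_eq_abs, abs_le]
    constructor <;> linarith [h.2.1, h.2.2.1, h.2.2.2]

end SensorModel

theorem theorem1 {K N : ℕ} {E : Fin K → Type*} [∀ k, MeasurableSpace (E k)]
    (M : SensorModel E N)
    (P : Finset (Finset (Fin N))) (p : Finset (Fin N) → ℝ)
    (hp_pos : ∀ A ∈ P, 0 < p A) (hp_sum : ∑ A ∈ P, p A = 1)
    (h_ac : ∀ A ∈ P, M.law (SensorModel.param A) ≪ M.law 0) :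
    (∀ γ : ℝ, 1 ≤ γ →
      M.glrCusum P p (Real.log γ) ∈ M.ruleClass γ ∧
      M.mixCusumBar P p (Real.log γ) ∈ M.ruleClass γ ∧
      M.mixCusumTilde P p (Real.log γ) ∈ M.ruleClass γ) ∧
    ((∀ A ∈ P, M.law (SensorModel.param A) ≠ M.law 0) →
      (∀ A ∈ P, MemLp (fun ω => (M.logLR A (ω 0)).toReal) 2 (M.change A 0)) →
      (M.SecondOrderOptimal P (fun γ => M.glrCusum P p (Real.log γ)) ∧
        M.SecondOrderOptimal P (fun γ => M.mixCusumBar P p (Real.log γ)) ∧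
        M.SecondOrderOptimal P (fun γ => M.mixCusumTilde P p (Real.log γ))) ∧
      (M.HasSecondOrderDelay P (fun γ => M.glrCusum P p (Real.log γ)) ∧
        M.HasSecondOrderDelay P (fun γ => M.mixCusumBar P p (Real.log γ)) ∧
        M.HasSecondOrderDelay P (fun γ => M.mixCusumTilde P p (Real.log γ)))) := by
  have hglr : ∀ γ : ℝ, 1 ≤ γ → M.IsCusumRule P p γ (M.glrCusum P p (Real.log γ)) :=
    fun _ hγ => SensorModel.isCusumRule_glrCusum hp_pos hp_sum hγ
  have hbar : ∀ γ : ℝ, 1 ≤ γ → M.IsCusumRule P p γ (M.mixCusumBar P p (Real.log γ)) :=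
    fun _ hγ => SensorModel.isCusumRule_mixCusumBar hp_pos hp_sum hγ
  have htilde : ∀ γ : ℝ, 1 ≤ γ → M.IsCusumRule P p γ (M.mixCusumTilde P p (Real.log γ)) :=
    fun _ hγ => SensorModel.isCusumRule_mixCusumTilde hγ
  refine ⟨fun γ hγ => ⟨(hglr γ hγ).mem_ruleClass hγ hp_pos hp_sum h_ac,
    (hbar γ hγ).mem_ruleClass hγ hp_pos hp_sum h_ac,
    (htilde γ hγ).mem_ruleClass hγ hp_pos hp_sum h_ac⟩, fun hne hsq => ?_⟩
  have h1 := SensorModel.secondOrderOptimal_and_hasSecondOrderDelay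
    hglr hp_pos hp_sum h_ac hne hsq
  have h2 := SensorModel.secondOrderOptimal_and_hasSecondOrderDelay
    hbar hp_pos hp_sum h_ac hne hsq
  have h3 := SensorModel.secondOrderOptimal_and_hasSecondOrderDelay
    htilde hp_pos hp_sum h_ac hne hsq
  exact ⟨⟨h1.1, h2.1, h3.1⟩, h1.2, h2.2, h3.2⟩
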